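/- Let $\mathfrak g$ be a finite-dimensional complex simple Lie algebra with Chevalley generators $h_i,x_i^{\pm}$ ($i\in I$, $|I|=r$), $[h_i,x_j^\pm]=\pm C_{ij}x_j^\pm$, $[x^+_i,x^-_j]=\delta_{ij}h_i$, Cartan subalgebra $\mathfrak h$ spanned by the $h_i$, and let $G\subset GL_n(\mathbb C)$ be the connected complex simple Lie group with Lie algebra $\mathfrak g$ (given by a faithful representation of $\mathfrak g$). Let $H$, $N^{\pm}$ be the connected subgroups of $G$ with Lie algebras $\mathfrak h$ and $\mathfrak n^\pm=\langle x_i^\pm\rangle$, $B^\pm=HN^\pm$, $B=B^+$, and let $\theta^\pm:B^\pm\to H$ be the projections, $\theta=\theta^+$. The double of $B$ is $D(B)=G\times H$, with embeddings $i:B\to D(B)$, $i(b)=(b,\theta(b))$, and $j:B^-\to D(B)$, $j(b)=(b,\theta^-(b)^{-1})$; put $I(g^+,g^-)=i(g^+)j(g^-)^{-1}$ for $(g^+,g^-)\in B\times B^-$. The symplectic leaf of $D(B)$ through $x_0$ is the connected component containing $x_0$ of $\{x\in D(B):(x,x)\in J\,(x_0,x_0)\,J\}$, where $J=\{(j(b^-),i(b)):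 b^-\in B^-,\,b\in B\}\subset D(B)\times D(B)$. The factorization relation on $B\times B^-$ consists of the pairs $((g^+,g^-),(h^+,h^-))$ with $i(g^+)j(g^-)^{-1}=j(h^-)^{-1}i(h^+)$. Let $w=s_{i_1}\cdots s_{i_r}$ be a Coxeter element of the Weyl group with a fixed reduced decomposition (each simple reflection occurs exactly once), and let $S=S_{w,w}$ be a symplectic leaf of $D(B)$ contained in $(B^-wB^-\cap BwB)\times H$. For $A_i,B_i,C_i,D_i\in\mathbb C^\times$ put $U_i=A_i^{h_i}\exp(\tfrac{B_i}{A_i}x_i^+)$ and $L_i=D_i^{h_i}\exp(C_iD_ix_i^-)$ (the images in $G$ of $\begin{pmatrix}A_i&B_i\\0&A_i^{-1}\end{pmatrix}$ and $\begin{pmatrix}D_i&0\\C_i&D_i^{-1}\end{pmatrix}$ under the $i$-th $SL_2$), $U=U_{i_1}\cdots U_{i_r}$, $L=L_{i_r}\cdots L_{i_1}$. Let $S'\subset S$ be the set of the elements of $S$ of the form $I(U,L)=(UL^{-1},\theta(U)\theta^-(L))$, and assume that $S'\ne\emptyset$. Let $\mathcal F\subset S'\times S'$ be the set of pairs $(I(p),I(q))\in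 S'\times S'$ with $(p,q)$ in the factorization relation; so for $x=(UL^{-1},\cdot)$, $y=(\bar U\bar L^{-1},\cdot)$ it demands $UL^{-1}=\bar L^{-1}\bar U$ and $\theta(U)\theta^-(L)=\theta(\bar U)\theta^-(\bar L)$. Writing $j\prec i$ if $s_j$ stands before $s_i$ in the decomposition, put $$V_i=B_iA_i\prod_{j\prec i}A_j^{C_{ji}},\quad W_i=C_iD_i^{-1}\prod_{i\prec j}D_j^{-C_{ji}},\quad \chi_i^+=V_iW_i,\quad \chi_i^-=\chi_i^+\prod_j\Big(\frac{A_j}{D_j}\Big)^{-C_{ji}},$$ and define $\alpha$ on $\{(\chi^+,\chi^-)\in(\mathbb C^\times)^{2r}:\chi^-_j\neq1\text{ for all }j\}$, with values in $(\mathbb C^\times)^{2r}$, by $$\alpha(\chi_i^+)=\chi_i^-,\qquad \alpha(\chi_i^-)=\frac{(\chi_i^-)^2}{\chi_i^+}\prod_j(1-\chi_j^-)^{-C_{ji}} .$$ Proposition. The assignment $(A_i,B_i,C_i,D_i)\mapsto(\chi_i^\pm)$ is a well-defined surjective map $\chi:S'\to(\mathbb C^\times)^{2r}$. Let $\chi_L,\chi_R:\mathcal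 F\to(\mathbb C^\times)^{2r}$ be the compositions of $\chi$ with the projections to the first and the second component. Then $\chi_L$ takes values in the domain of $\alpha$ and $\chi_R=\alpha\circ\chi_L$, i.e. the diagram formed by $\chi_L$, $\chi_R$ and $\alpha$ commutes. Moreover, every $x\in S'$ with $\chi(x)$ in the domain of $\alpha$ is the first component of some $(x,y)\in\mathcal F$. Hence the image of $\mathcal F$ under $(\chi_L,\chi_R)$ is exactly the graph of $\alpha$. -/

import Mathlib

-- the commutator bracket on matrices
attribute [local instance 100] LieRing.ofAssociativeRing

namespace CoxeterToda

noncomputable section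

open Matrix

section Torus

variable {ι : Type*}

/-- The torus `(ℂˣ)^{2r}`; a point is a pair `(χ⁺, χ⁻)`. -/
abbrev Torus (ι : Type*) : Type _ := (ι → ℂˣ) × (ι → ℂˣ)

/-- The domain of `α`: the complement of the hyperplanes `χ⁻_j = 1`. -/
def alphaDom (ι : Type*) : Set (Torus ι) := {p | ∀ j, (p.2 j : ℂ) ≠ 1}

/-- The map `α(χ⁺_i) = χ⁻_i`,
`α(χ⁻_i) = (χ⁻_i)² / χ⁺_i * ∏_j (1 - χ⁻_j) ^ (-C_{ji})`. -/
def alpha [Fintype ι] (C : Matrix ι ι ℤ) (p : alphaDom ι) : Torus ι :=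
  (p.1.2, fun i => p.1.2 i ^ 2 / p.1.1 i *
    ∏ j, Units.mk0 (1 - (p.1.2 j : ℂ)) (sub_ne_zero.2 (p.2 j).symm) ^ (-C j i))

/-- The coordinates `(A_i, B_i, C_i, D_i)`. -/
structure Coords (ι : Type*) where
  A : ι → ℂˣ
  B : ι → ℂˣ
  C : ι → ℂˣ
  D : ι → ℂˣ

/-! A Coxeter element with a fixed reduced decomposition `s_{i_1} ⋯ s_{i_r}` is given by an
enumeration `w : Fin r ≃ ι` of the simple roots (`w k` is the `k`-th letter). So `j ∈ {i}_-`
(`j` stands before `i`) reads `w.symm j < w.symm i`, and `j ∈ {i}_+` reads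
`w.symm i < w.symm j`. -/

variable [Fintype ι] {r : ℕ}

/-- `V_i = B_i A_i ∏_{j ∈ {i}_-} A_j ^ C_{ji}`. -/
def coordV (C : Matrix ι ι ℤ) (w : Fin r ≃ ι) (q : Coords ι) (i : ι) : ℂˣ :=
  q.B i * q.A i * ∏ j with w.symm j < w.symm i, q.A j ^ C j i

/-- `W_i = C_i D_i⁻¹ ∏_{j ∈ {i}_+} D_j ^ (-C_{ji})`. -/
def coordW (C : Matrix ι ι ℤ) (w : Fin r ≃ ι) (q : Coords ι) (i : ι) : ℂˣ :=
  q.C i * (q.D i)⁻¹ * ∏ j with w.symm i < w.symm j, q.D j ^ (-C j i)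

/-- The map `(A_i, B_i, C_i, D_i) ↦ (χ⁺_i, χ⁻_i)` with
`χ⁺_i = V_i W_i` and `χ⁻_i = χ⁺_i ∏_j (A_j / D_j) ^ (-C_{ji})`. -/
def chi (C : Matrix ι ι ℤ) (w : Fin r ≃ ι) (q : Coords ι) : Torus ι :=
  (fun i => coordV C w q i * coordW C w q i,
   fun i => coordV C w q i * coordW C w q i * ∏ j, (q.A j / q.D j) ^ (-C j i))

end Torus

section Groups

variable {𝔤 : Type*} [LieRing 𝔤] [LieAlgebra ℂ 𝔤] {n : ℕ}

/-- `exp (ρ x)` as an element of `GL_n(ℂ)`. -/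
def expG (ρ : 𝔤 →ₗ⁅ℂ⁆ Matrix (Fin n) (Fin n) ℂ) (x : 𝔤) : GL (Fin n) ℂ :=
  (Matrix.isUnit_exp (ρ x)).unit

/-- The connected (immersed) subgroup of `GL_n(ℂ)` with Lie algebra `ρ(𝔨)`. -/
def analyticSubgroup (ρ : 𝔤 →ₗ⁅ℂ⁆ Matrix (Fin n) (Fin n) ℂ) (𝔨 : LieSubalgebra ℂ 𝔤) :
    Subgroup (GL (Fin n) ℂ) :=
  Subgroup.closure (expG ρ '' (𝔨 : Set 𝔤))

variable (ρ : 𝔤 →ₗ⁅ℂ⁆ Matrix (Fin n) (Fin n) ℂ)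

/-- The group `G`. -/
def grpG : Subgroup (GL (Fin n) ℂ) := analyticSubgroup ρ ⊤

variable {ι : Type*} [Finite ι] {𝔥 : LieSubalgebra ℂ 𝔤} (b : LieAlgebra.Basis ι 𝔥)

/-- The Cartan matrix, with the convention `[h_i, x_j^±] = ± C_{ij} x_j^±`. -/
def cartan : Matrix ι ι ℤ := b.Aᵀ

/-- The Cartan subgroup `H`. -/
def grpH : Subgroup (GL (Fin n) ℂ) := analyticSubgroup ρ 𝔥

/-- `N = N⁺`. -/
def grpN : Subgroup (GL (Fin n) ℂ) :=
  analyticSubgroup ρ (LieSubalgebra.lieSpan ℂ 𝔤 (Set.range b.e))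

/-- `N⁻`. -/
def grpNm : Subgroup (GL (Fin n) ℂ) :=
  analyticSubgroup ρ (LieSubalgebra.lieSpan ℂ 𝔤 (Set.range b.f))

/-- The Borel subgroup `B = H N`. -/
def grpB : Subgroup (GL (Fin n) ℂ) := grpH ρ (𝔥 := 𝔥) ⊔ grpN ρ b

/-- The opposite Borel subgroup `B⁻ = H N⁻`. -/
def grpBm : Subgroup (GL (Fin n) ℂ) := grpH ρ (𝔥 := 𝔥) ⊔ grpNm ρ b

open Classical in
/-- The component in `H` of an element of `H N` (for `H` normalizing `N` and `H ∩ N = 1`), that is,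
the projection `H N → H N / N ≅ H`. Elements outside `H N` are sent to `1`. -/
def torusPart (H N : Subgroup (GL (Fin n) ℂ)) (g : GL (Fin n) ℂ) : GL (Fin n) ℂ :=
  if h : ∃ t ∈ H, t⁻¹ * g ∈ N then h.choose else 1

/-- `θ : B → H`. -/
def theta (g : GL (Fin n) ℂ) : GL (Fin n) ℂ := torusPart (grpH ρ (𝔥 := 𝔥)) (grpN ρ b) g

/-- `θ⁻ : B⁻ → H`. -/
def thetam (g : GL (Fin n) ℂ) : GL (Fin n) ℂ := torusPart (grpH ρ (𝔥 := 𝔥)) (grpNm ρ b) g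

/-- The ambient group of `D(B) = G × H`. -/
abbrev Amb (n : ℕ) : Type := GL (Fin n) ℂ × GL (Fin n) ℂ

/-- The double `D(B) = G × H` of `B`. -/
def dblB : Subgroup (Amb n) := (grpG ρ).prod (grpH ρ (𝔥 := 𝔥))

/-- The inclusion `B → D(B)`, `b ↦ (b, θ(b))`. -/
def inclB (g : GL (Fin n) ℂ) : Amb n := (g, theta ρ b g)

/-- The inclusion `B⁻ → D(B)`, `b⁻ ↦ (b⁻, θ⁻(b⁻)⁻¹)`. -/
def inclBm (g : GL (Fin n) ℂ) : Amb n := (g, (thetam ρ b g)⁻¹)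

/-- The map `I : B × B⁻ → D(B)`, `(g⁺, g⁻) ↦ i(g⁺) j(g⁻)⁻¹ = (g⁺ (g⁻)⁻¹, θ(g⁺) θ⁻(g⁻))`. -/
def mapI (p : GL (Fin n) ℂ × GL (Fin n) ℂ) : Amb n := inclB ρ b p.1 * (inclBm ρ b p.2)⁻¹

/-- The factorization relation: pairs `((g⁺, g⁻), (h⁺, h⁻))` in `(B × B⁻) × (B × B⁻)` with
`i(g⁺) j(g⁻)⁻¹ = j(h⁻)⁻¹ i(h⁺)` in `D(B)`. -/
def factRel :
    Set ((GL (Fin n) ℂ × GL (Fin n) ℂ) × (GL (Fin n) ℂ × GL (Fin n) ℂ)) :=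
  {z | (z.1.1 ∈ grpB ρ b ∧ z.1.2 ∈ grpBm ρ b) ∧ (z.2.1 ∈ grpB ρ b ∧ z.2.2 ∈ grpBm ρ b) ∧
    inclB ρ b z.1.1 * (inclBm ρ b z.1.2)⁻¹ = (inclBm ρ b z.2.2)⁻¹ * inclB ρ b z.2.1}

/-- The image of `D(B)^{*op} ≅ B⁻ × B` in the double `D(D(B)) = D(B) × D(B)`. -/
def dualDbl : Set (Amb n × Amb n) :=
  {a | ∃ g ∈ grpBm ρ b, ∃ g' ∈ grpB ρ b, a = (inclBm ρ b g, inclB ρ b g')}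

/-- The symplectic leaf of `D(B)` through `x₀`: the connected component containing `x₀` of the
preimage, under the diagonal map `φ : D(B) → (D(B) × D(B)) / D(B)^{*op}`, of the left
`D(B)^{*op}`-orbit of `φ(x₀)`. -/
def symplecticLeaf (x₀ : Amb n) : Set (Amb n) :=
  connectedComponentIn
    {x | x ∈ dblB ρ (𝔥 := 𝔥) ∧ ∃ a ∈ dualDbl ρ b, ∃ c ∈ dualDbl ρ b,
      (x, x) = a * (x₀, x₀) * c} x₀

/-- The cell `P ẇ P`, for `ẇ ∈ N_G(H)` a representative of the Weyl group element acting on the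
Cartan subalgebra by `w`. -/
def bruhatCell (P : Subgroup (GL (Fin n) ℂ)) (w : 𝔥 →ₗ[ℂ] 𝔥) : Set (GL (Fin n) ℂ) :=
  {g | ∃ a ∈ P, ∃ c ∈ P, ∃ m ∈ grpG ρ,
    (∀ x : 𝔥, m * expG ρ (x : 𝔤) * m⁻¹ = expG ρ (w x : 𝔤)) ∧ g = a * m * c}

/-- The `D(B)`-cell `D(B)_w ∩ D(B)^w = (B⁻ w B⁻ ∩ B w B) × H`. -/
def doubleCell (w : 𝔥 →ₗ[ℂ] 𝔥) : Set (Amb n) :=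
  (bruhatCell ρ (grpBm ρ b) w ∩ bruhatCell ρ (grpB ρ b) w) ×ˢ
    (grpH ρ (𝔥 := 𝔥) : Set (GL (Fin n) ℂ))

/-- `U_i(A, B) = A^{h_i} exp((B/A) x_i^+)`, the image in `G` of the matrix `[A, B; 0, A⁻¹]`. -/
def facU (i : ι) (A B : ℂˣ) : GL (Fin n) ℂ :=
  expG ρ (Complex.log A • b.h i) * expG ρ (((B : ℂ) / A) • b.e i)

/-- `L_i(D, C) = D^{h_i} exp(C D x_i^-)`, the image in `G` of the matrix `[D, 0; C, D⁻¹]`. -/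
def facL (i : ι) (D C : ℂˣ) : GL (Fin n) ℂ :=
  expG ρ (Complex.log D • b.h i) * expG ρ (((C : ℂ) * D) • b.f i)

variable {r : ℕ}

/-- `U = U_{i_1}(A_{i_1}, B_{i_1}) ⋯ U_{i_r}(A_{i_r}, B_{i_r})`. -/
def prodU (w : Fin r ≃ ι) (q : Coords ι) : GL (Fin n) ℂ :=
  (List.ofFn fun k => facU ρ b (w k) (q.A (w k)) (q.B (w k))).prod

/-- `L = L_{i_r}(D_{i_r}, C_{i_r}) ⋯ L_{i_1}(D_{i_1}, C_{i_1})`. -/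
def prodL (w : Fin r ≃ ι) (q : Coords ι) : GL (Fin n) ℂ :=
  (List.ofFn fun k : Fin r =>
    facL ρ b (w k.rev) (q.D (w k.rev)) (q.C (w k.rev))).prod

/-- The point `I(U, L) = (U L⁻¹, diag(U) diag(L))` of `D(B)` with coordinates `q`. -/
def point (w : Fin r ≃ ι) (q : Coords ι) : Amb n := mapI ρ b (prodU ρ b w q, prodL ρ b w q)

/-- The part `S'` of `S` on which the coordinates `(A_i, B_i, C_i, D_i)` are defined. -/
def chartPart (w : Fin r ≃ ι) (S : Set (Amb n)) : Set (Amb n) :=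
  {x ∈ S | ∃ q : Coords ι, point ρ b w q = x}

/-- The factorization relation, transported to `D(B)` by `I` and restricted to `S' × S'`. -/
def factRelOn (w : Fin r ≃ ι) (S : Set (Amb n)) :
    Set (chartPart ρ b w S × chartPart ρ b w S) :=
  {z | ∃ p q, (p, q) ∈ factRel ρ b ∧ mapI ρ b p = z.1 ∧ mapI ρ b q = z.2}

end Groups

section Weyl

variable {𝔤 : Type*} [LieRing 𝔤] [LieAlgebra ℂ 𝔤] {n : ℕ}
  (ρ : 𝔤 →ₗ⁅ℂ⁆ Matrix (Fin n) (Fin n) ℂ)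
  {ι : Type*} [Fintype ι] {𝔥 : LieSubalgebra ℂ 𝔤} (b : LieAlgebra.Basis ι 𝔥) {r : ℕ}

/-- The Coxeter element `s_{i_1} ⋯ s_{i_r}` acting on the Cartan subalgebra, where
`s_i(x) = x - α_i(x) h_i`. -/
def coxeter (w : Fin r ≃ ι) : 𝔥 →ₗ[ℂ] 𝔥 :=
  (List.ofFn fun k => (Module.preReflection (b.h' (w k)) (b.baseSupp (w k)) :
    Module.End ℂ 𝔥)).prod

/-- `S` is a Coxeter symplectic leaf `S_{w,w}` of `D(B)`. -/
def IsCoxeterLeaf (w : Fin r ≃ ι) (S : Set (Amb n)) : Prop :=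
  (∃ x₀ ∈ dblB ρ (𝔥 := 𝔥), S = symplecticLeaf ρ b x₀) ∧ S ⊆ doubleCell ρ b (coxeter b w)

end Weyl

end

end CoxeterToda

/-! Write E(V) and F(W) for the ordered products of the exp(V_i x_i^+) and of the exp(W_i x_i^-) in
the order of the Coxeter word. Pushing all torus factors to the right gives U = E(V) t_A, and L is
the product of the exp(W_i x_i^-) in reversed order times t_D. Since L runs through the word
backwards, L⁻¹ lists the letters in the order of U, and with t = t_A t_D⁻¹ one gets UL⁻¹ = E(V) F(γ)
t, where γ_i = -W_i α_i(t)⁻¹. Here V_i W_i = χ⁺_i and V_i γ_i = -χ⁻_i.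

Well-definedness is the uniqueness of the Gauss decomposition (`gauss_unique`) together with the
injectivity of E and F in their parameters: the point determines V, W and t. For surjectivity, any
two points of the chart are related by J on both sides and the parameter space is connected, so a
leaf meeting the chart contains all of it (`chartPt_mem_symplecticLeaf`). Then V and W are free, and
so are the α_i(t), because the Cartan matrix is invertible.

The factorization relation asks to rewrite E(V) F(γ) t with the lower factors in front. Every simple
root occurs once and x_i^+ commutes with x_j^- for i ≠ j, so this is r independent computations in
SL₂, namely exp(βe) exp(γf) = exp(γf/(1+βγ)) (1+βγ)^h exp(βe/(1+βγ)) (`exp_raise_mul_exp_lower`,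
`exists_prodE_mul_prodF_eq`). With 1 + V_i γ_i = 1 - χ⁻_i, the new torus part is t ∏ (1-χ⁻_j)^{h_j}
and the new product V'_i W'_i is χ⁻_i. Reading off the root characters gives α.

The SL₂ formula needs χ⁻_i ≠ 1. That this is forced by the relation is a growth argument: both sides
of the factorization conjugate the fundamental coweight, and for χ⁻_k = 1 only one side produces a
term growing like x_k^+ (`one_add_mul_ne_zero`). Conversely, if no χ⁻_i equals 1, the
refactorization exists, and dividing its torus part evenly between the two factors preserves the
H-component. -/

namespace CoxeterToda

noncomputable section

open Matrix

/-! ### Exponential identities in a Banach algebra, proved by linear differential equations -/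

section BanachAlgebra

open NormedSpace

variable {𝔸 : Type*} [NormedRing 𝔸] [NormedAlgebra ℂ 𝔸] [CompleteSpace 𝔸]

theorem exp_neg_mul_self (x : 𝔸) : exp (-x) * exp x = 1 := by
  let : NormedAlgebra ℚ 𝔸 := NormedAlgebra.restrictScalars ℚ ℂ 𝔸
  rw [← exp_add_of_commute (Commute.neg_left (Commute.refl x)), neg_add_cancel, exp_zero]

theorem exp_mul_neg_self (x : 𝔸) : exp x * exp (-x) = 1 := by
  simpa using exp_neg_mul_self (-x)

theorem hasDerivAt_exp_smul_comp {u : ℂ → ℂ} {u' t : ℂ} (hu : HasDerivAt u u' t) (x : 𝔸) :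
    HasDerivAt (fun t => exp (u t • x)) (u' • (exp (u t • x) * x)) t :=
  (hasDerivAt_exp_smul_const x (u t)).scomp t hu

theorem hasDerivAt_exp_smul_comp' {u : ℂ → ℂ} {u' t : ℂ} (hu : HasDerivAt u u' t) (x : 𝔸) :
    HasDerivAt (fun t => exp (u t • x)) (u' • (x * exp (u t • x))) t :=
  (hasDerivAt_exp_smul_const' x (u t)).scomp t hu

/-- A solution of the Lax equation `M' = [X, M]` is the conjugation orbit of its initial value. -/
theorem exp_mul_of_lax {X : 𝔸} {M : ℂ → 𝔸}
    (hM : ∀ t, HasDerivAt M (X * M t - M t * X) t) (t : ℂ) :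
    exp (t • X) * M 0 = M t * exp (t • X) := by
  have key : ∀ t, HasDerivAt (fun t => exp ((-t) • X) * M t * exp (t • X)) 0 t := by
    intro t
    have h1 := hasDerivAt_exp_smul_comp (hasDerivAt_neg t) X
    have h2 := hasDerivAt_exp_smul_comp' (hasDerivAt_id t) X
    have := (h1.mul (hM t)).mul h2
    refine this.congr_deriv ?_
    simp only [Pi.mul_apply, id, neg_smul, one_smul]
    noncomm_ring
  have hc := is_const_of_deriv_eq_zero (fun t => (key t).differentiableAt)
    (fun t => (key t).deriv) t 0
  simp only [neg_smul, zero_smul, neg_zero, exp_zero, one_mul, mul_one] at hc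
  rw [← hc, ← mul_assoc, ← mul_assoc, exp_mul_neg_self, one_mul]

theorem eq_mul_exp_of_hasDerivAt {X : 𝔸} {M : ℂ → 𝔸}
    (hM : ∀ t, HasDerivAt M (M t * X) t) (t : ℂ) : M t = M 0 * exp (t • X) := by
  have key : ∀ t, HasDerivAt (fun t => M t * exp ((-t) • X)) 0 t := by
    intro t
    have h1 := hasDerivAt_exp_smul_comp' (hasDerivAt_neg t) X
    refine ((hM t).mul h1).congr_deriv ?_
    simp only [neg_smul, one_smul]
    noncomm_ring
  have hc := is_const_of_deriv_eq_zero (fun t => (key t).differentiableAt)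
    (fun t => (key t).deriv) t 0
  simp only [neg_smul, zero_smul, neg_zero, exp_zero, mul_one] at hc
  rw [← hc, mul_assoc, exp_neg_mul_self, mul_one]

theorem exp_mul_of_eigen {X Y : 𝔸} {c : ℂ} (h : X * Y - Y * X = c • Y) (t : ℂ) :
    exp (t • X) * Y = (Complex.exp (t * c) • Y) * exp (t • X) := by
  have := exp_mul_of_lax (X := X) (M := fun t => Complex.exp (t * c) • Y) (fun t => by
    have h1 : HasDerivAt (fun t => Complex.exp (t * c)) (Complex.exp (t * c) * (1 * c)) t :=
      ((hasDerivAt_id t).mul_const c).cexp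
    refine (h1.smul_const Y).congr_deriv ?_
    simp only [mul_smul_comm, smul_mul_assoc, ← smul_sub, h, smul_smul, one_mul]) t
  simpa using this

/-- If `[x, ·]` maps `m` and the closed subspace `W` into `W`, then conjugation by `exp x` fixes
`m` modulo `W`. -/
theorem exp_mul_mul_exp_neg_sub_mem {x m : 𝔸} {W : Submodule ℂ 𝔸} (hc : IsClosed (W : Set 𝔸))
    (hW : ∀ w ∈ W, x * w - w * x ∈ W) (hm : x * m - m * x ∈ W) :
    exp x * m * exp (-x) - m ∈ W := by
  let A : 𝔸 →L[ℂ] 𝔸 := ContinuousLinearMap.mul ℂ 𝔸 x - (ContinuousLinearMap.mul ℂ 𝔸).flip x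
  have hA : ∀ z, A z = x * z - z * x := fun z => rfl
  -- This is Ad(exp x) = exp(ad x); all terms of the series on m beyond the zeroth lie in W, which
  -- is closed.
  have hexp : exp x * m = exp A m * exp x := by
    have := exp_mul_of_lax (X := x) (M := fun t => exp (t • A) m) (fun t => by
      have h1 := (hasDerivAt_exp_smul_const' (𝕂 := ℂ) A t).clm_apply (hasDerivAt_const t m)
      simpa [hA] using h1) 1
    have h0 : exp ((0 : ℂ) • A) m = m := by
      rw [show (0 : ℂ) • A = 0 from zero_smul ℂ A, exp_zero, one_apply_eq_self]
    rw [one_smul, show (1 : ℂ) • A = A from one_smul ℂ A] at this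
    exact (congrArg _ h0.symm).trans this
  have hmem : ∀ k : ℕ, (A ^ (k + 1)) m ∈ W := by
    intro k
    induction k with
    | zero => simpa [hA] using hm
    | succ k ih => rw [pow_succ']; exact hW _ ih
  have hsum : HasSum (fun k : ℕ => ((Nat.factorial k : ℂ)⁻¹ • A ^ k) m) (exp A m) :=
    (exp_series_hasSum_exp' (𝕂 := ℂ) A).mapL (ContinuousLinearMap.apply ℂ 𝔸 m)
  have hlim : exp A m - m ∈ W := by
    have ht := (hsum.tendsto_sum_nat.comp (Filter.tendsto_add_atTop_nat 1)).sub_const m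
    refine hc.mem_of_tendsto ht (Filter.Eventually.of_forall fun k => ?_)
    simp only [Function.comp_apply, Finset.sum_range_succ']
    simp only [Nat.factorial_zero, Nat.cast_one, inv_one, pow_zero, one_smul,
      one_apply_eq_self, add_sub_cancel_right]
    exact W.sum_mem fun i _ => W.smul_mem _ (hmem i)
  rwa [hexp, mul_assoc, exp_mul_neg_self, mul_one]

section Triple

variable {e f h : 𝔸} (hef : e * f - f * e = h) (hhe : h * e - e * h = (2 : ℂ) • e)
  (hhf : h * f - f * h = -((2 : ℂ) • f))

include hef hhe in
-- The series of ad e on f stops after the second order, so the orbit of f is a quadratic polynomial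
-- path. It is parametrized to equal f at time t.
theorem lower_mul_exp_raise (t : ℂ) :
    f * exp (t • e) = exp (t • e) * (f - t • h - t ^ 2 • e) := by
  have := exp_mul_of_lax (X := e) (M := fun s => f + (s - t) • h - (s - t) ^ 2 • e) (fun s => by
    have h0 := (hasDerivAt_id s).sub_const t
    refine ((h0.smul_const h).const_add f |>.sub ((h0.pow 2).smul_const e)).congr_deriv ?_
    have : e * f = f * e + h := by rw [← hef]; abel
    have h2 : e * h = h * e - (2 : ℂ) • e := by rw [← hhe]; abel
    simp only [mul_add, mul_sub, add_mul, sub_mul, mul_smul_comm, smul_mul_assoc, this, h2]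
    simp only [id, Nat.cast_ofNat]
    module) t
  simp only [zero_sub, sub_self] at this
  rw [show f = f + (0 : ℂ) • h - (0 : ℂ) ^ 2 • e by simp, ← this]
  simp [sub_eq_add_neg]

include hhe in
theorem cartan_mul_exp_raise (t : ℂ) :
    h * exp (t • e) = exp (t • e) * (h + (2 * t) • e) := by
  have := exp_mul_of_lax (X := e) (M := fun s => h - (2 * (s - t)) • e) (fun s => by
    have h0 := ((hasDerivAt_id s).sub_const t).const_mul 2
    refine ((h0.smul_const e).const_sub h).congr_deriv ?_
    have h2 : e * h = h * e - (2 : ℂ) • e := by rw [← hhe]; abel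
    simp only [mul_sub, sub_mul, mul_smul_comm, smul_mul_assoc, h2]
    module) t
  simp only [zero_sub, sub_self] at this
  rw [show h = h - (2 * (0 : ℂ)) • e by simp, ← this]
  simp [sub_eq_add_neg]

include hef hhe hhf in
/-- The two opposite Gauss decompositions in `SL₂`. -/
theorem exp_raise_mul_exp_lower {β γ s : ℂ} (hβ : β ≠ 0) (hs : Complex.exp s = 1 + β * γ) :
    exp (β • e) * exp (γ • f) = exp ((γ * Complex.exp (-s)) • f) * exp (s • h) *
      exp ((β * Complex.exp (-s)) • e) := by
  have hfe : f * e - e * f = -h := by rw [← hef]; abel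
  have hhf' : -h * f - f * -h = (2 : ℂ) • f := by
    rw [neg_mul, mul_neg, sub_neg_eq_add, ← neg_neg ((2 : ℂ) • f), ← hhf]; abel
  have hE := lower_mul_exp_raise hef hhe
  have hF := lower_mul_exp_raise hfe hhf'
  have hhE := cartan_mul_exp_raise hhe
  have hhF := cartan_mul_exp_raise hhf'
  -- Solving the claimed identity for exp(s h) and letting γ = v(s) vary with β fixed gives a path
  -- Φ(s) = exp(uf) exp(βe) exp(vf) exp(ye). It satisfies Φ' = Φh and Φ(0) = 1, hence Φ(s) =
  -- exp(sh).
  set u : ℂ → ℂ := fun s => -((1 - Complex.exp (-s)) / β) with hu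
  set v : ℂ → ℂ := fun s => (Complex.exp s - 1) / β with hv
  set y : ℂ → ℂ := fun s => -(β * Complex.exp (-s)) with hy
  have hu' : ∀ s, HasDerivAt u (-(Complex.exp (-s) / β)) s := fun s =>
    ((((hasDerivAt_neg s).cexp.const_sub 1).div_const β).neg).congr_deriv (by ring)
  have hv' : ∀ s, HasDerivAt v (Complex.exp s / β) s := fun s =>
    (((Complex.hasDerivAt_exp s).sub_const 1).div_const β)
  have hy' : ∀ s, HasDerivAt y (β * Complex.exp (-s)) s := fun s =>
    (((hasDerivAt_neg s).cexp.const_mul β).neg).congr_deriv (by ring)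
  have key : ∀ s, HasDerivAt
      (fun s => exp (u s • f) * exp (β • e) * exp (v s • f) * exp (y s • e))
      (exp (u s • f) * exp (β • e) * exp (v s • f) * exp (y s • e) * h) s := by
    intro s
    have hmain := (((hasDerivAt_exp_smul_comp (hu' s) f).mul_const (exp (β • e))).mul
      (hasDerivAt_exp_smul_comp (hv' s) f)).mul (hasDerivAt_exp_smul_comp (hy' s) e)
    refine hmain.congr_deriv ?_
    set D := Complex.exp s with hD
    have hD0 : D ≠ 0 := Complex.exp_ne_zero s
    have hDn : Complex.exp (-s) = D⁻¹ := Complex.exp_neg s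
    have hvs : v s = (D - 1) / β := rfl
    have hys : y s = -(β * D⁻¹) := by simp only [hy, hDn]
    rw [hDn]
    have e1 : (f - β • h - β ^ 2 • e) * exp (v s • f) =
        exp (v s • f) * (D ^ 2 • f - (β * D) • h - β ^ 2 • e) := by
      have a1 : h * exp (v s • f) = exp (v s • f) * (h - (2 * v s) • f) := by
        have := hhF (v s)
        rw [neg_mul] at this
        rw [← neg_inj, this, ← mul_neg]; congr 1; abel
      have a2 : f * exp (v s • f) = exp (v s • f) * f :=
        (((Commute.refl f).smul_right (v s)).exp_right).eq
      rw [sub_mul, sub_mul, smul_mul_assoc, smul_mul_assoc, hF, a1, a2]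
      simp only [← mul_smul_comm, ← mul_sub]
      congr 1
      rw [hvs]
      match_scalars <;> field_simp <;> ring
    have e2 : (h + (β * D⁻¹) • e) * exp (y s • e) =
        exp (y s • e) * (h - (β * D⁻¹) • e) := by
      have a2 : e * exp (y s • e) = exp (y s • e) * e :=
        (((Commute.refl e).smul_right (y s)).exp_right).eq
      rw [add_mul, smul_mul_assoc, hhE, a2, ← mul_smul_comm, ← mul_add, hys]
      congr 1
      module
    calc _ = exp (u s • f) * exp (β • e) *
          ((-(D⁻¹ / β)) • (exp (v s • f) * (D ^ 2 • f - (β * D) • h - β ^ 2 • e)) +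
            (D / β) • (exp (v s • f) * f)) * exp (y s • e) +
          (β * D⁻¹) • (exp (u s • f) * exp (β • e) * exp (v s • f) * (exp (y s • e) * e)) := by
          have : ∀ z, exp (β • e) * ((f - β • h - β ^ 2 • e) * z) = f * (exp (β • e) * z) :=
            fun z => by rw [← mul_assoc, ← hE β, mul_assoc]
          simp only [← e1, Pi.mul_apply, mul_add, add_mul, mul_smul_comm, smul_mul_assoc,
            mul_assoc, this]
      _ = exp (u s • f) * exp (β • e) * exp (v s • f) *
          ((h + (β * D⁻¹) • e) * exp (y s • e)) +
          (β * D⁻¹) • (exp (u s • f) * exp (β • e) * exp (v s • f) * (exp (y s • e) * e)) := by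
          congr 1
          rw [← mul_smul_comm, ← mul_smul_comm, ← mul_add]
          simp only [mul_assoc]
          congr 4
          match_scalars <;> field_simp
          ring
      _ = _ := by
          rw [e2]
          simp only [mul_sub, mul_smul_comm, mul_assoc]
          abel
  have hΦ := eq_mul_exp_of_hasDerivAt key s
  have hβ1 := exp_mul_neg_self (β • e)
  have h0 : exp (u 0 • f) * exp (β • e) * exp (v 0 • f) * exp (y 0 • e) = 1 := by
    simp [hu, hv, hy, hβ1]
  rw [h0, one_mul] at hΦ
  have hvs : v s = γ := by rw [hv]; simp only [hs]; field_simp; ring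
  have hus : u s = -(γ * Complex.exp (-s)) := by
    have := Complex.exp_ne_zero s
    simp only [hu, ← hvs, hv, Complex.exp_neg]
    field_simp
  rw [← hΦ, hvs, hus]
  simp only [hy, neg_smul]
  simp only [mul_assoc, exp_neg_mul_self, mul_one]
  rw [← mul_assoc (exp ((γ * Complex.exp (-s)) • f)), exp_mul_neg_self, one_mul]

include hef hhe hhf in
-- The Gauss identity with β = 1, γ = 0 allows s = 2πi as well as s = 0.
theorem exp_two_pi_I_smul_cartan : exp ((2 * Real.pi * Complex.I : ℂ) • h) = 1 := by
  have hs : Complex.exp (2 * Real.pi * Complex.I) = 1 + 1 * 0 := by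
    simp [Complex.exp_two_pi_mul_I]
  have := exp_raise_mul_exp_lower hef hhe hhf one_ne_zero hs
  rw [Complex.exp_neg, hs] at this
  simp only [zero_smul, exp_zero, mul_one, add_zero, inv_one, one_mul, one_smul] at this
  have h2 := congrArg (· * exp (-e)) this
  simpa [mul_assoc, exp_mul_neg_self] using h2.symm

end Triple

end BanachAlgebra

/-! ### Matrix exponentials, conjugation and contraction -/

section Exponential

attribute [local instance] Matrix.linftyOpNormedRing Matrix.linftyOpNormedAlgebra

open Filter Topology

variable {n : ℕ}

/-- Conjugation of matrices by an invertible matrix. -/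
def conjMat (g : GL (Fin n) ℂ) : Matrix (Fin n) (Fin n) ℂ →ₗ[ℂ] Matrix (Fin n) (Fin n) ℂ :=
  LinearMap.mulLeft ℂ (g : Matrix (Fin n) (Fin n) ℂ) ∘ₗ
    LinearMap.mulRight ℂ ((g⁻¹ : GL (Fin n) ℂ) : Matrix (Fin n) (Fin n) ℂ)

theorem conjMat_apply (g : GL (Fin n) ℂ) (M : Matrix (Fin n) (Fin n) ℂ) :
    conjMat g M = g * M * (g⁻¹ : GL (Fin n) ℂ) := by
  simp [conjMat, mul_assoc]

theorem conjMat_mul (g k : GL (Fin n) ℂ) (M : Matrix (Fin n) (Fin n) ℂ) :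
    conjMat (g * k) M = conjMat g (conjMat k M) := by
  simp only [conjMat_apply, _root_.mul_inv_rev, Units.val_mul, mul_assoc]

theorem conjMat_coe (g k : GL (Fin n) ℂ) :
    conjMat g (k : Matrix (Fin n) (Fin n) ℂ) = ((g * k * g⁻¹ : GL (Fin n) ℂ) : Matrix _ _ ℂ) := by
  simp only [conjMat_apply, Units.val_mul]

@[simp] theorem conjMat_one (M : Matrix (Fin n) (Fin n) ℂ) : conjMat 1 M = M := by
  simp [conjMat_apply]

theorem conjMat_inv_conjMat (g : GL (Fin n) ℂ) (M : Matrix (Fin n) (Fin n) ℂ) :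
    conjMat g⁻¹ (conjMat g M) = M := by
  rw [← conjMat_mul, inv_mul_cancel, conjMat_one]

theorem conjMat_eq_of_mul_eq {g : GL (Fin n) ℂ} {M M' : Matrix (Fin n) (Fin n) ℂ}
    (h : (g : Matrix (Fin n) (Fin n) ℂ) * M = M' * g) : conjMat g M = M' := by
  rw [conjMat_apply, h, mul_assoc, Units.mul_inv, mul_one]

theorem conjMat_inv_eq_of_mul_eq {g : GL (Fin n) ℂ} {M M' : Matrix (Fin n) (Fin n) ℂ}
    (h : M * (g : Matrix (Fin n) (Fin n) ℂ) = g * M') : conjMat g⁻¹ M = M' := by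
  rw [conjMat_apply, inv_inv, mul_assoc, h, ← mul_assoc, Units.inv_mul, one_mul]

theorem conjMat_map_mul (g : GL (Fin n) ℂ) (M M' : Matrix (Fin n) (Fin n) ℂ) :
    conjMat g (M * M') = conjMat g M * conjMat g M' := by
  simp only [conjMat_apply, mul_assoc]
  rw [← mul_assoc ((g⁻¹ : GL (Fin n) ℂ) : Matrix (Fin n) (Fin n) ℂ) g, Units.inv_mul, one_mul]

variable {𝔤 : Type*} [LieRing 𝔤] [LieAlgebra ℂ 𝔤] (ρ : 𝔤 →ₗ⁅ℂ⁆ Matrix (Fin n) (Fin n) ℂ)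

theorem map_lie_eq (x y : 𝔤) : ρ ⁅x, y⁆ = ρ x * ρ y - ρ y * ρ x := by
  rw [LieHom.map_lie]; rfl

theorem coe_expG (x : 𝔤) :
    (expG ρ x : Matrix (Fin n) (Fin n) ℂ) = NormedSpace.exp (ρ x) := rfl

@[simp] theorem expG_zero : expG ρ 0 = 1 := by
  ext1; simp [coe_expG]

theorem expG_add {x y : 𝔤} (h : ⁅x, y⁆ = 0) : expG ρ (x + y) = expG ρ x * expG ρ y := by
  have hc : Commute (ρ x) (ρ y) := by
    have := map_lie_eq ρ x y
    rw [h, map_zero] at this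
    exact (sub_eq_zero.1 this.symm)
  ext1
  simp only [coe_expG, Units.val_mul, map_add]
  exact Matrix.exp_add_of_commute _ _ hc

theorem expG_neg (x : 𝔤) : expG ρ (-x) = (expG ρ x)⁻¹ := by
  rw [eq_inv_iff_mul_eq_one, ← expG_add ρ (by simp), neg_add_cancel, expG_zero]

theorem commute_expG {x y : 𝔤} (h : ⁅x, y⁆ = 0) : Commute (expG ρ x) (expG ρ y) := by
  have h' : ⁅y, x⁆ = 0 := by rw [← lie_skew, h, neg_zero]
  rw [commute_iff_eq, ← expG_add ρ h, ← expG_add ρ h', add_comm]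

theorem coe_conj_expG {g : GL (Fin n) ℂ} {x y : 𝔤} (h : conjMat g (ρ x) = ρ y) :
    g * expG ρ x * g⁻¹ = expG ρ y := by
  ext1
  simp only [coe_expG, Units.val_mul]
  rw [← Matrix.exp_units_conj, ← h, conjMat_apply]

theorem conjMat_expG_of_lie_eq_smul {x y : 𝔤} {c : ℂ} (h : ⁅x, y⁆ = c • y) :
    conjMat (expG ρ x) (ρ y) = Complex.exp c • ρ y := by
  refine conjMat_eq_of_mul_eq ?_
  have := exp_mul_of_eigen (X := ρ x) (Y := ρ y) (c := c) (by rw [← map_lie_eq, h, map_smul]) 1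
  simp only [one_smul, one_mul] at this
  exact this

theorem conjMat_expG_of_lie_eq_zero {x y : 𝔤} (h : ⁅x, y⁆ = 0) :
    conjMat (expG ρ x) (ρ y) = ρ y := by
  simpa using conjMat_expG_of_lie_eq_smul ρ (x := x) (y := y) (c := 0) (by simpa using h)

theorem expG_mul_expG_of_lie_eq_smul {x y : 𝔤} {c : ℂ} (h : ⁅x, y⁆ = c • y) (z : ℂ) :
    expG ρ x * expG ρ (z • y) = expG ρ ((Complex.exp c * z) • y) * expG ρ x := by
  rw [← mul_inv_eq_iff_eq_mul]
  refine coe_conj_expG ρ ?_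
  rw [map_smul, map_smul, conjMat_expG_of_lie_eq_smul ρ h, map_smul, smul_smul, mul_comm]

theorem conjMat_expG_sub_mem {y m : 𝔤} {W : Submodule ℂ 𝔤}
    (hW : ∀ w ∈ W, ⁅y, w⁆ ∈ W) (hm : ⁅y, m⁆ ∈ W) :
    conjMat (expG ρ y) (ρ m) - ρ m ∈ W.map (ρ : 𝔤 →ₗ[ℂ] Matrix (Fin n) (Fin n) ℂ) := by
  rw [conjMat_apply, ← expG_neg, coe_expG, coe_expG, map_neg]
  refine exp_mul_mul_exp_neg_sub_mem (Submodule.closed_of_finiteDimensional _) ?_ ?_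
  · rintro _ ⟨w, hw, rfl⟩
    exact ⟨⁅y, w⁆, hW w hw, map_lie_eq ρ y w⟩
  · exact ⟨⁅y, m⁆, hm, map_lie_eq ρ y m⟩

theorem continuous_expG_comp {X : Type*} [TopologicalSpace X] {φ : X → 𝔤}
    (h : Continuous fun x => ρ (φ x)) : Continuous fun x => expG ρ (φ x) := by
  let : NormedAlgebra ℚ (Matrix (Fin n) (Fin n) ℂ) := NormedAlgebra.restrictScalars ℚ ℂ _
  refine Units.continuous_iff.2 ⟨NormedSpace.exp_continuous.comp h, ?_⟩
  simp only [← expG_neg]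
  have h' : Continuous fun x => ρ (-φ x) := by simp only [map_neg]; exact Continuous.neg h
  exact NormedSpace.exp_continuous.comp h'

/-- The elements of `GL_n(ℂ)` contracted to `1` by conjugation with `exp (s x)`, `s → -∞`. -/
def contracting (x : 𝔤) : Subgroup (GL (Fin n) ℂ) where
  carrier := {g | Tendsto (fun s : ℝ => conjMat (expG ρ ((s : ℂ) • x)) g) atBot (𝓝 1) ∧
    Tendsto (fun s : ℝ => conjMat (expG ρ ((s : ℂ) • x)) (g⁻¹ : GL (Fin n) ℂ)) atBot (𝓝 1)}
  mul_mem' := by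
    rintro g k ⟨h1, h2⟩ ⟨h3, h4⟩
    refine ⟨?_, ?_⟩
    · simpa only [Units.val_mul, conjMat_map_mul, mul_one] using h1.mul h3
    · simpa only [_root_.mul_inv_rev, Units.val_mul, conjMat_map_mul, mul_one] using h4.mul h2
  one_mem' := by simp [conjMat_apply]
  inv_mem' := by
    rintro g ⟨h1, h2⟩
    exact ⟨h2, by simpa using h1⟩

theorem eq_one_of_mem_contracting {x : 𝔤} {g : GL (Fin n) ℂ} (hg : g ∈ contracting ρ x)
    (hc : ∀ s : ℝ, Commute (expG ρ ((s : ℂ) • x)) g) : g = 1 := by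
  have h1 := hg.1
  have : ∀ s : ℝ, conjMat (expG ρ ((s : ℂ) • x)) (g : Matrix (Fin n) (Fin n) ℂ) = g := by
    intro s
    rw [conjMat_coe, (hc s).eq, mul_inv_cancel_right]
  simp only [this] at h1
  exact Units.ext (tendsto_nhds_unique tendsto_const_nhds h1)

/-- Generators scale by e^s. Tending to 0 is inherited by brackets, since a bracket is a difference
of matrix products, so no weight decomposition is needed. -/
theorem tendsto_conjMat_expG_of_mem_lieSpan {x : 𝔤} {E : Set 𝔤} (hE : ∀ e ∈ E, ⁅x, e⁆ = e)
    {y : 𝔤} (hy : y ∈ LieSubalgebra.lieSpan ℂ 𝔤 E) :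
    Tendsto (fun s : ℝ => conjMat (expG ρ ((s : ℂ) • x)) (ρ y)) atBot (𝓝 0) := by
  induction hy using LieSubalgebra.lieSpan_induction with
  | mem e he =>
    have h1 : ∀ s : ℝ, conjMat (expG ρ ((s : ℂ) • x)) (ρ e) = ((Real.exp s : ℝ) : ℂ) • ρ e := by
      intro s
      rw [conjMat_expG_of_lie_eq_smul ρ (c := s) (by rw [smul_lie, hE e he]), Complex.ofReal_exp]
    simp only [h1]
    have := ((Complex.continuous_ofReal.tendsto 0).comp Real.tendsto_exp_atBot).smul_const (ρ e)
    simpa using this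
  | zero => simp
  | add u v _ _ hu hv => simpa using hu.add hv
  | smul t u _ hu => simpa using hu.const_smul t
  | lie u v _ _ hu hv =>
    simpa only [map_lie_eq, map_sub, conjMat_map_mul, mul_zero, sub_zero] using
      (hu.mul hv).sub (hv.mul hu)

theorem analyticSubgroup_lieSpan_le_contracting {x : 𝔤} {E : Set 𝔤} (hE : ∀ e ∈ E, ⁅x, e⁆ = e) :
    analyticSubgroup ρ (LieSubalgebra.lieSpan ℂ 𝔤 E) ≤ contracting ρ x := by
  let : NormedAlgebra ℚ (Matrix (Fin n) (Fin n) ℂ) := NormedAlgebra.restrictScalars ℚ ℂ _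
  have key : ∀ y ∈ LieSubalgebra.lieSpan ℂ 𝔤 E,
      Tendsto (fun s : ℝ => conjMat (expG ρ ((s : ℂ) • x)) (expG ρ y)) atBot (𝓝 1) := by
    intro y hy
    have h := tendsto_conjMat_expG_of_mem_lieSpan ρ hE hy
    have h2 := (NormedSpace.exp_continuous.tendsto (0 : Matrix (Fin n) (Fin n) ℂ)).comp h
    rw [NormedSpace.exp_zero] at h2
    refine h2.congr fun s => ?_
    simp only [Function.comp_apply, conjMat_apply, coe_expG ρ y]
    exact Matrix.exp_units_conj _ _
  rw [analyticSubgroup, Subgroup.closure_le]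
  rintro _ ⟨y, hy, rfl⟩
  exact ⟨key y hy, by rw [← expG_neg]; exact key _ (neg_mem (S := LieSubalgebra ℂ 𝔤) hy)⟩

end Exponential

/-! ### The groups H, N, B and the Gauss decomposition -/

section Cartan

variable {𝔤 : Type*} [LieRing 𝔤] [LieAlgebra ℂ 𝔤] {n : ℕ}
  {ι : Type*} [Fintype ι] {𝔥 : LieSubalgebra ℂ 𝔤} (b : LieAlgebra.Basis ι 𝔥)
  (ρ : 𝔤 →ₗ⁅ℂ⁆ Matrix (Fin n) (Fin n) ℂ)

/-- The element `∑ c_j h_j` of the Cartan subalgebra. -/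
def hSum : (ι → ℂ) →ₗ[ℂ] 𝔤 := Fintype.linearCombination ℂ b.h

/-- The value `∑ c_j C_{jk}` of the simple root `α_k` at `∑ c_j h_j`. -/
def rootEval (k : ι) : (ι → ℂ) →ₗ[ℂ] ℂ :=
  Fintype.linearCombination ℂ fun j => (b.A k j : ℂ)

theorem hSum_apply (c : ι → ℂ) : hSum b c = ∑ j, c j • b.h j := rfl

theorem rootEval_apply (k : ι) (c : ι → ℂ) : rootEval b k c = ∑ j, c j * (b.A k j : ℂ) := rfl

/-- Passing to `b.symm` exchanges the x_i^+ with the x_i^- and negates the h_i, keeping the Cartan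
matrix. Every statement about N or B thereby yields one about N⁻ or B⁻, with torus parameters
negated. -/
theorem hSum_symm (c : ι → ℂ) : hSum b.symm c = hSum b (-c) := by
  simp [hSum_apply]

theorem rootEval_symm (k : ι) : rootEval b.symm k = rootEval b k := rfl

theorem hSum_single [DecidableEq ι] (i : ι) (x : ℂ) : hSum b (Pi.single i x) = x • b.h i := by
  simp [hSum, Fintype.linearCombination_apply_single]

theorem rootEval_single [DecidableEq ι] (k i : ι) (x : ℂ) :
    rootEval b k (Pi.single i x) = x * b.A k i := by
  simp [rootEval, Fintype.linearCombination_apply_single]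

theorem lie_hSum_e (c : ι → ℂ) (k : ι) : ⁅hSum b c, b.e k⁆ = rootEval b k c • b.e k := by
  simp [hSum_apply, rootEval_apply, sum_lie, b.lie_h_e, Finset.sum_smul, mul_smul,
    Int.cast_smul_eq_zsmul]

theorem lie_hSum_f (c : ι → ℂ) (k : ι) : ⁅hSum b c, b.f k⁆ = -rootEval b k c • b.f k := by
  have := lie_hSum_e b.symm (-c) k
  rw [hSum_symm, rootEval_symm, neg_neg, map_neg] at this
  exact this

theorem lie_hSum_hSum (c c' : ι → ℂ) : ⁅hSum b c, hSum b c'⁆ = 0 := by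
  simp [hSum_apply, sum_lie, lie_sum, b.lie_h_h]

theorem mem_cartan_iff {x : 𝔤} : x ∈ 𝔥 ↔ ∃ c, hSum b c = x := by
  rw [← LieSubalgebra.mem_toSubmodule, b.coe_cartan_eq_span, Submodule.mem_span_range_iff_exists_fun]
  rfl

theorem hSum_mem_cartan (c : ι → ℂ) : hSum b c ∈ 𝔥 := (mem_cartan_iff b).2 ⟨c, rfl⟩

/-- Invertibility of the Cartan matrix. It supplies the grading element, the fundamental coweights,
and torus elements with prescribed root characters. -/
theorem exists_rootEval_eq (v : ι → ℂ) : ∃ c, ∀ k, rootEval b k c = v k := by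
  classical
  have hdet : ((Int.castRingHom ℂ).mapMatrix b.A).det ≠ 0 := by
    rw [← RingHom.map_det]
    simpa using! b.nondegen.det_ne_zero
  have hu : IsUnit ((Int.castRingHom ℂ).mapMatrix b.A).det := isUnit_iff_ne_zero.2 hdet
  refine ⟨((Int.castRingHom ℂ).mapMatrix b.A)⁻¹ *ᵥ v, fun k => ?_⟩
  have : ((Int.castRingHom ℂ).mapMatrix b.A) *ᵥ
      (((Int.castRingHom ℂ).mapMatrix b.A)⁻¹ *ᵥ v) = v := by
    rw [mulVec_mulVec, mul_nonsing_inv _ hu, one_mulVec]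
  conv_rhs => rw [← this]
  rw [rootEval_apply]
  conv_rhs => rw [mulVec, dotProduct]
  exact Finset.sum_congr rfl fun j _ => mul_comm _ _

/-- The element `exp (∑ c_j h_j)` of `H`. -/
def tor (c : ι → ℂ) : GL (Fin n) ℂ := expG ρ (hSum b c)

theorem tor_symm (c : ι → ℂ) : tor b.symm ρ c = tor b ρ (-c) := by
  rw [tor, hSum_symm, tor]

@[simp] theorem tor_zero : tor b ρ 0 = 1 := by simp [tor]

theorem tor_add (c c' : ι → ℂ) : tor b ρ (c + c') = tor b ρ c * tor b ρ c' := by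
  rw [tor, map_add, expG_add ρ (lie_hSum_hSum b c c'), tor, tor]

theorem tor_neg (c : ι → ℂ) : tor b ρ (-c) = (tor b ρ c)⁻¹ := by
  rw [tor, map_neg, expG_neg, tor]

theorem tor_sub (c c' : ι → ℂ) : tor b ρ (c - c') = tor b ρ c * (tor b ρ c')⁻¹ := by
  rw [sub_eq_add_neg, tor_add, tor_neg]

theorem commute_tor (c c' : ι → ℂ) : Commute (tor b ρ c) (tor b ρ c') :=
  commute_expG ρ (lie_hSum_hSum b c c')

theorem mem_grpH_iff {g : GL (Fin n) ℂ} : g ∈ grpH ρ (𝔥 := 𝔥) ↔ ∃ c, g = tor b ρ c := by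
  constructor
  · intro hg
    refine Subgroup.closure_induction (p := fun g _ => ∃ c, g = tor b ρ c) ?_ ?_ ?_ ?_ hg
    · rintro _ ⟨x, hx, rfl⟩
      obtain ⟨c, rfl⟩ := (mem_cartan_iff b).1 hx
      exact ⟨c, rfl⟩
    · exact ⟨0, by simp⟩
    · rintro _ _ _ _ ⟨c, rfl⟩ ⟨c', rfl⟩
      exact ⟨c + c', (tor_add b ρ c c').symm⟩
    · rintro _ _ ⟨c, rfl⟩
      exact ⟨-c, (tor_neg b ρ c).symm⟩
  · rintro ⟨c, rfl⟩
    exact Subgroup.subset_closure ⟨_, hSum_mem_cartan b c, rfl⟩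

theorem tor_mem_grpH (c : ι → ℂ) : tor b ρ c ∈ grpH ρ (𝔥 := 𝔥) := (mem_grpH_iff b ρ).2 ⟨c, rfl⟩

theorem tor_mem_grpB (c : ι → ℂ) : tor b ρ c ∈ grpB ρ b :=
  (le_sup_left : _ ≤ grpB ρ b) (tor_mem_grpH b ρ c)

theorem tor_mem_grpBm (c : ι → ℂ) : tor b ρ c ∈ grpBm ρ b :=
  (le_sup_left : _ ≤ grpBm ρ b) (tor_mem_grpH b ρ c)

theorem grpBm_symm : grpBm ρ b.symm = grpB ρ b := rfl

theorem thetam_symm : thetam ρ b.symm = theta ρ b := rfl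

theorem expG_e_mem_grpN (z : ℂ) (k : ι) : expG ρ (z • b.e k) ∈ grpN ρ b :=
  Subgroup.subset_closure ⟨_, LieSubalgebra.smul_mem _ z
    (LieSubalgebra.subset_lieSpan (Set.mem_range_self k)), rfl⟩

theorem grpN_le_grpB : grpN ρ b ≤ grpB ρ b := le_sup_right

theorem grpNm_le_grpBm : grpNm ρ b ≤ grpBm ρ b := le_sup_right

theorem analyticSubgroup_le_grpG (𝔨 : LieSubalgebra ℂ 𝔤) : analyticSubgroup ρ 𝔨 ≤ grpG ρ :=
  Subgroup.closure_mono (Set.image_mono fun _ _ => trivial)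

theorem grpB_le_grpG : grpB ρ b ≤ grpG ρ :=
  sup_le (analyticSubgroup_le_grpG ρ _) (analyticSubgroup_le_grpG ρ _)

theorem grpBm_le_grpG : grpBm ρ b ≤ grpG ρ := grpB_le_grpG b.symm ρ

/-- Some element of the Cartan subalgebra contracts `N` to `1`. -/
theorem exists_grpN_le_contracting : ∃ c, grpN ρ b ≤ contracting ρ (hSum b c) := by
  obtain ⟨c, hc⟩ := exists_rootEval_eq b fun _ => 1
  refine ⟨c, analyticSubgroup_lieSpan_le_contracting ρ ?_⟩
  rintro _ ⟨k, rfl⟩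
  rw [lie_hSum_e, hc, one_smul]

/-- Conjugation by a one-parameter subgroup of H contracts g to 1, yet fixes it. -/
theorem eq_one_of_mem_grpN_of_forall_commute {g : GL (Fin n) ℂ} (hg : g ∈ grpN ρ b)
    (h : ∀ c, Commute (tor b ρ c) g) : g = 1 := by
  obtain ⟨c, hc⟩ := exists_grpN_le_contracting b ρ
  refine eq_one_of_mem_contracting ρ (hc hg) fun s => ?_
  rw [← map_smul]
  exact h _

theorem eq_one_of_mem_grpH_of_mem_grpN {g : GL (Fin n) ℂ} (hg : g ∈ grpH ρ (𝔥 := 𝔥))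
    (hg' : g ∈ grpN ρ b) : g = 1 := by
  obtain ⟨c, rfl⟩ := (mem_grpH_iff b ρ).1 hg
  exact eq_one_of_mem_grpN_of_forall_commute b ρ hg' fun c' => commute_tor b ρ c' c

theorem lie_hSum_mem {y : 𝔤} (c : ι → ℂ)
    (hy : y ∈ LieSubalgebra.lieSpan ℂ 𝔤 (Set.range b.e)) :
    ⁅hSum b c, y⁆ ∈ LieSubalgebra.lieSpan ℂ 𝔤 (Set.range b.e) :=
  b.borelUpper.lie_mem (x := ⟨hSum b c, hSum_mem_cartan b c⟩) hy

theorem conjMat_tor_mem (c : ι → ℂ) {y : 𝔤}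
    (hy : y ∈ LieSubalgebra.lieSpan ℂ 𝔤 (Set.range b.e)) :
    ∃ y' ∈ LieSubalgebra.lieSpan ℂ 𝔤 (Set.range b.e), conjMat (tor b ρ c) (ρ y) = ρ y' := by
  obtain ⟨z, hz, hz'⟩ := conjMat_expG_sub_mem ρ (y := hSum b c) (m := y)
    (W := (LieSubalgebra.lieSpan ℂ 𝔤 (Set.range b.e)).toSubmodule)
    (fun w hw => lie_hSum_mem b c hw) (lie_hSum_mem b c hy)
  refine ⟨z + y, add_mem (S := LieSubalgebra ℂ 𝔤) hz hy, ?_⟩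
  rw [map_add, ← sub_eq_iff_eq_add]
  exact hz'.symm

theorem grpH_le_normalizer : grpH ρ (𝔥 := 𝔥) ≤ Subgroup.normalizer (grpN ρ b) := by
  rw [grpN, analyticSubgroup, Subgroup.le_normalizer_closure_iff]
  rintro _ hg _ ⟨y, hy, rfl⟩
  obtain ⟨c, rfl⟩ := (mem_grpH_iff b ρ).1 hg
  obtain ⟨y', hy', h⟩ := conjMat_tor_mem b ρ c hy
  rw [coe_conj_expG ρ h]
  exact Subgroup.subset_closure ⟨y', hy', rfl⟩

theorem tor_conj_mem_grpN (c : ι → ℂ) {g : GL (Fin n) ℂ} (hg : g ∈ grpN ρ b) :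
    tor b ρ c * g * (tor b ρ c)⁻¹ ∈ grpN ρ b :=
  Subgroup.le_normalizer_iff.1 (grpH_le_normalizer b ρ) _ (tor_mem_grpH b ρ c) _ hg

theorem mem_grpB_iff {g : GL (Fin n) ℂ} :
    g ∈ grpB ρ b ↔ ∃ c, ∃ u ∈ grpN ρ b, g = tor b ρ c * u := by
  rw [← SetLike.mem_coe, grpB, Subgroup.coe_mul_of_left_le_normalizer_right _ _
    (grpH_le_normalizer b ρ), Set.mem_mul]
  constructor
  · rintro ⟨t, ht, u, hu, rfl⟩
    obtain ⟨c, rfl⟩ := (mem_grpH_iff b ρ).1 ht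
    exact ⟨c, u, hu, rfl⟩
  · rintro ⟨c, u, hu, rfl⟩
    exact ⟨_, tor_mem_grpH b ρ c, u, hu, rfl⟩

/-- The choice in `torusPart` is forced, because H ∩ N = 1. -/
theorem theta_tor_mul (c : ι → ℂ) {u : GL (Fin n) ℂ} (hu : u ∈ grpN ρ b) :
    theta ρ b (tor b ρ c * u) = tor b ρ c := by
  have h : ∃ t ∈ grpH ρ (𝔥 := 𝔥), t⁻¹ * (tor b ρ c * u) ∈ grpN ρ b :=
    ⟨_, tor_mem_grpH b ρ c, by rwa [inv_mul_cancel_left]⟩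
  rw [theta, torusPart, dif_pos h]
  obtain ⟨h1, h2⟩ := h.choose_spec
  generalize h.choose = t at h1 h2
  have h3 := eq_one_of_mem_grpH_of_mem_grpN b ρ (mul_mem (inv_mem h1) (tor_mem_grpH b ρ c))
    ((Subgroup.mul_mem_cancel_right _ hu).1 (by rwa [mul_assoc]))
  exact (inv_mul_eq_one.1 h3)

theorem theta_mul_tor (c : ι → ℂ) {u : GL (Fin n) ℂ} (hu : u ∈ grpN ρ b) :
    theta ρ b (u * tor b ρ c) = tor b ρ c := by
  have h := tor_conj_mem_grpN b ρ (-c) hu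
  have := theta_tor_mul b ρ c h
  conv_rhs => rw [← this]
  congr 1
  rw [tor_neg]
  group

theorem theta_of_mem_grpN {u : GL (Fin n) ℂ} (hu : u ∈ grpN ρ b) : theta ρ b u = 1 := by
  simpa using theta_tor_mul b ρ 0 hu

theorem theta_tor (c : ι → ℂ) : theta ρ b (tor b ρ c) = tor b ρ c := by
  simpa using theta_tor_mul b ρ c (one_mem _)

theorem theta_mem_grpH {g : GL (Fin n) ℂ} (hg : g ∈ grpB ρ b) :
    theta ρ b g ∈ grpH ρ (𝔥 := 𝔥) := by
  obtain ⟨c, u, hu, rfl⟩ := (mem_grpB_iff b ρ).1 hg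
  rw [theta_tor_mul b ρ c hu]
  exact tor_mem_grpH b ρ c

theorem theta_mul {g k : GL (Fin n) ℂ} (hg : g ∈ grpB ρ b) (hk : k ∈ grpB ρ b) :
    theta ρ b (g * k) = theta ρ b g * theta ρ b k := by
  obtain ⟨c, u, hu, rfl⟩ := (mem_grpB_iff b ρ).1 hg
  obtain ⟨c', u', hu', rfl⟩ := (mem_grpB_iff b ρ).1 hk
  have h := mul_mem (tor_conj_mem_grpN b ρ (-c') hu) hu'
  rw [theta_tor_mul b ρ c hu, theta_tor_mul b ρ c' hu', ← tor_add, ← theta_tor_mul b ρ (c + c') h]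
  congr 1
  rw [tor_neg, tor_add]
  group

theorem theta_inv {g : GL (Fin n) ℂ} (hg : g ∈ grpB ρ b) :
    theta ρ b g⁻¹ = (theta ρ b g)⁻¹ := by
  rw [eq_inv_iff_mul_eq_one, ← theta_mul b ρ (inv_mem hg) hg, inv_mul_cancel,
    theta_of_mem_grpN b ρ (one_mem _)]

theorem thetam_mul_tor (c : ι → ℂ) {u : GL (Fin n) ℂ} (hu : u ∈ grpNm ρ b) :
    thetam ρ b (u * tor b ρ c) = tor b ρ c := by
  have := theta_mul_tor b.symm ρ (-c) hu
  rwa [tor_symm, neg_neg] at this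

theorem thetam_of_mem_grpNm {u : GL (Fin n) ℂ} (hu : u ∈ grpNm ρ b) : thetam ρ b u = 1 :=
  theta_of_mem_grpN b.symm ρ hu

theorem thetam_mem_grpH {g : GL (Fin n) ℂ} (hg : g ∈ grpBm ρ b) :
    thetam ρ b g ∈ grpH ρ (𝔥 := 𝔥) := theta_mem_grpH b.symm ρ hg

theorem thetam_tor (c : ι → ℂ) : thetam ρ b (tor b ρ c) = tor b ρ c := by
  have := theta_tor b.symm ρ (-c)
  rwa [tor_symm, neg_neg] at this

theorem thetam_mul {g k : GL (Fin n) ℂ} (hg : g ∈ grpBm ρ b) (hk : k ∈ grpBm ρ b) :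
    thetam ρ b (g * k) = thetam ρ b g * thetam ρ b k := theta_mul b.symm ρ hg hk

theorem thetam_inv {g : GL (Fin n) ℂ} (hg : g ∈ grpBm ρ b) :
    thetam ρ b g⁻¹ = (thetam ρ b g)⁻¹ := theta_inv b.symm ρ hg

theorem disjoint_borel : Disjoint
    (LieSubalgebra.lieSpan ℂ 𝔤 (Set.range b.e)).toSubmodule
    (LieSubalgebra.lieSpan ℂ 𝔤 (Set.range b.f)).toSubmodule := by
  have h := b.iSupIndep_rootSpace.pairwiseDisjoint (show (2 : Fin 3) ≠ 1 by decide)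
  have h' : Disjoint b.borelUpper b.borelLower :=
    Disjoint.mono b.borelUpper_le_biSup b.borelLower_le_biSup h
  exact LieSubmodule.disjoint_toSubmodule.2 h'

/-- `N` moves the elements of `𝔥` by elements of `𝔫`. -/
theorem conjMat_sub_mem_of_mem_grpN {g : GL (Fin n) ℂ} (hg : g ∈ grpN ρ b) :
    (∀ y ∈ LieSubalgebra.lieSpan ℂ 𝔤 (Set.range b.e),
      ∃ y' ∈ LieSubalgebra.lieSpan ℂ 𝔤 (Set.range b.e), conjMat g (ρ y) = ρ y') ∧
    ∀ c, ∃ y ∈ LieSubalgebra.lieSpan ℂ 𝔤 (Set.range b.e),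
      conjMat g (ρ (hSum b c)) = ρ (hSum b c) + ρ y := by
  set W := LieSubalgebra.lieSpan ℂ 𝔤 (Set.range b.e)
  let P : GL (Fin n) ℂ → Prop := fun g => (∀ y ∈ W, ∃ y' ∈ W, conjMat g (ρ y) = ρ y') ∧
    ∀ c, ∃ y ∈ W, conjMat g (ρ (hSum b c)) = ρ (hSum b c) + ρ y
  have hmul : ∀ g k, P g → P k → P (g * k) := by
    rintro g k ⟨h1, h2⟩ ⟨h3, h4⟩
    refine ⟨fun y hy => ?_, fun c => ?_⟩
    · obtain ⟨y', hy', h⟩ := h3 y hy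
      obtain ⟨y'', hy'', h'⟩ := h1 y' hy'
      exact ⟨y'', hy'', by rw [conjMat_mul, h, h']⟩
    · obtain ⟨y, hy, h⟩ := h4 c
      obtain ⟨y', hy', h'⟩ := h1 y hy
      obtain ⟨y'', hy'', h''⟩ := h2 c
      exact ⟨y'' + y', add_mem (S := LieSubalgebra ℂ 𝔤) hy'' hy', by
        rw [conjMat_mul, h, map_add, h', h'', map_add, add_assoc]⟩
  have hgen : ∀ y ∈ W, P (expG ρ y) := by
    intro y hy
    have key : ∀ m, ⁅y, m⁆ ∈ W → ∃ z ∈ W, conjMat (expG ρ y) (ρ m) = ρ m + ρ z := by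
      intro m hm
      obtain ⟨z, hz, h⟩ := conjMat_expG_sub_mem ρ (W := W.toSubmodule)
        (fun w hw => W.lie_mem hy hw) hm
      exact ⟨z, hz, (sub_eq_iff_eq_add'.1 h.symm)⟩
    refine ⟨fun m hm => ?_, fun c => key _ ?_⟩
    · obtain ⟨z, hz, h⟩ := key m (W.lie_mem hy hm)
      exact ⟨m + z, add_mem (S := LieSubalgebra ℂ 𝔤) hm hz, by rw [h, map_add]⟩
    · rw [← lie_skew]
      exact neg_mem (S := LieSubalgebra ℂ 𝔤) (lie_hSum_mem b c hy)
  have h1 : P 1 := ⟨fun y hy => ⟨y, hy, by simp⟩,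
    fun c => ⟨0, zero_mem (S := LieSubalgebra ℂ 𝔤) _, by simp⟩⟩
  have hall : P g ∧ P g⁻¹ := by
    refine Subgroup.closure_induction (p := fun g _ => P g ∧ P g⁻¹) ?_ ?_ ?_ ?_ hg
    · rintro _ ⟨y, hy, rfl⟩
      exact ⟨hgen y hy, by rw [← expG_neg]; exact hgen _ (neg_mem (S := LieSubalgebra ℂ 𝔤) hy)⟩
    · exact ⟨h1, by simpa using h1⟩
    · rintro g k _ _ ⟨h1, h2⟩ ⟨h3, h4⟩
      exact ⟨hmul g k h1 h3, by rw [_root_.mul_inv_rev]; exact hmul _ _ h4 h2⟩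
    · rintro g _ ⟨h1, h2⟩
      exact ⟨h2, by simpa using h1⟩
  exact hall.1

variable (hρ : Function.Injective ρ)

include hρ in
-- For x in 𝔥, the difference gxg⁻¹ - x lies in 𝔫⁺ because g ∈ B, and in 𝔫⁻ because g ∈ N⁻, so it
-- vanishes. Thus g commutes with H and is trivial by contraction.
theorem eq_one_of_mem_grpB_of_mem_grpNm {g : GL (Fin n) ℂ} (hg : g ∈ grpB ρ b)
    (hg' : g ∈ grpNm ρ b) : g = 1 := by
  refine eq_one_of_mem_grpN_of_forall_commute b.symm ρ hg' fun c => ?_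
  obtain ⟨a, u, hu, rfl⟩ := (mem_grpB_iff b ρ).1 hg
  obtain ⟨y, hy, h⟩ := (conjMat_sub_mem_of_mem_grpN b.symm ρ hg').2 c
  obtain ⟨y', hy', h'⟩ := (conjMat_sub_mem_of_mem_grpN b ρ hu).2 (-c)
  obtain ⟨y'', hy'', h''⟩ := conjMat_tor_mem b ρ a hy'
  rw [hSum_symm] at h
  rw [conjMat_mul, h', map_add, h'', tor, conjMat_expG_of_lie_eq_zero ρ (lie_hSum_hSum b _ _),
    add_right_inj] at h
  have h0 : y'' = 0 := Submodule.disjoint_def.1 (disjoint_borel b) y'' hy'' (by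
    rw [hρ h]; exact hy)
  have h1 : conjMat (tor b ρ a * u) (ρ (hSum b (-c))) = ρ (hSum b (-c)) := by
    rw [conjMat_mul, h', map_add, h'', tor, conjMat_expG_of_lie_eq_zero ρ (lie_hSum_hSum b _ _),
      h0, map_zero, add_zero]
  have h2 := coe_conj_expG ρ h1
  rw [tor_symm, commute_iff_eq]
  exact (mul_inv_eq_iff_eq_mul.1 h2).symm

include hρ in
theorem mem_grpH_of_mem_grpB_of_mem_grpBm {g : GL (Fin n) ℂ} (hg : g ∈ grpB ρ b)
    (hg' : g ∈ grpBm ρ b) : ∃ c, g = tor b ρ c := by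
  obtain ⟨c, u, hu, rfl⟩ := (mem_grpB_iff b.symm ρ).1 hg'
  rw [tor_symm] at hg ⊢
  have := eq_one_of_mem_grpB_of_mem_grpNm b ρ hρ
    ((Subgroup.mul_mem_cancel_left _ (tor_mem_grpB b ρ _)).1 hg) hu
  exact ⟨-c, by rw [this, mul_one]⟩

include hρ in
/-- Uniqueness of the Gauss decomposition `N⁻ H N`. -/
theorem gauss_unique {v v' u u' : GL (Fin n) ℂ} {c c' : ι → ℂ} (hv : v ∈ grpNm ρ b)
    (hv' : v' ∈ grpNm ρ b) (hu : u ∈ grpN ρ b) (hu' : u' ∈ grpN ρ b)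
    (h : v * tor b ρ c * u = v' * tor b ρ c' * u') : v = v' ∧ tor b ρ c = tor b ρ c' ∧ u = u' := by
  have h1 : v'⁻¹ * v = tor b ρ c' * u' * u⁻¹ * (tor b ρ c)⁻¹ := by
    have : v = v' * tor b ρ c' * u' * u⁻¹ * (tor b ρ c)⁻¹ := by
      rw [eq_mul_inv_iff_mul_eq, eq_mul_inv_iff_mul_eq, h]
    rw [this]
    group
  have h2 : v'⁻¹ * v = 1 := by
    refine eq_one_of_mem_grpB_of_mem_grpNm b ρ hρ ?_ (mul_mem (inv_mem hv') hv)
    rw [h1]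
    exact mul_mem (mul_mem (mul_mem (tor_mem_grpB b ρ _) (grpN_le_grpB b ρ hu'))
      (inv_mem (grpN_le_grpB b ρ hu))) (inv_mem (tor_mem_grpB b ρ _))
  have h3 : v = v' := (inv_mul_eq_one.1 h2).symm
  subst h3
  rw [mul_assoc, mul_assoc, mul_right_inj] at h
  have h4 : (tor b ρ c')⁻¹ * tor b ρ c = 1 := by
    refine eq_one_of_mem_grpH_of_mem_grpN b ρ
      (mul_mem (inv_mem (tor_mem_grpH b ρ _)) (tor_mem_grpH b ρ _)) ?_
    rw [show (tor b ρ c')⁻¹ * tor b ρ c = u' * u⁻¹ by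
      rw [inv_mul_eq_iff_eq_mul, ← mul_assoc, eq_mul_inv_iff_mul_eq, h]]
    exact mul_mem hu' (inv_mem hu)
  have h5 : tor b ρ c = tor b ρ c' := (inv_mul_eq_one.1 h4).symm
  rw [h5, mul_right_inj] at h
  exact ⟨rfl, h5, h⟩

end Cartan

/-! ### Ordered products of root subgroup elements and their coordinates -/

section OrderedProducts

variable {𝔤 : Type*} [LieRing 𝔤] [LieAlgebra ℂ 𝔤] {n : ℕ}
  {ι : Type*} [Fintype ι] {𝔥 : LieSubalgebra ℂ 𝔤} (b : LieAlgebra.Basis ι 𝔥)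
  (ρ : 𝔤 →ₗ⁅ℂ⁆ Matrix (Fin n) (Fin n) ℂ)

/-- The ordered product of the elements `exp (V_i x_i^+)`. -/
def prodE (l : List ι) (V : ι → ℂ) : GL (Fin n) ℂ := (l.map fun i => expG ρ (V i • b.e i)).prod

/-- The ordered product of the elements `exp (V_i x_i^-)`. -/
def prodF (l : List ι) (V : ι → ℂ) : GL (Fin n) ℂ := prodE b.symm ρ l V

@[simp] theorem prodE_nil (V : ι → ℂ) : prodE b ρ [] V = 1 := rfl

theorem prodE_cons (i : ι) (l : List ι) (V : ι → ℂ) :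
    prodE b ρ (i :: l) V = expG ρ (V i • b.e i) * prodE b ρ l V := by
  simp [prodE]

theorem prodE_append (l l' : List ι) (V : ι → ℂ) :
    prodE b ρ (l ++ l') V = prodE b ρ l V * prodE b ρ l' V := by
  simp [prodE]

@[simp] theorem prodF_nil (V : ι → ℂ) : prodF b ρ [] V = 1 := rfl

theorem prodF_cons (i : ι) (l : List ι) (V : ι → ℂ) :
    prodF b ρ (i :: l) V = expG ρ (V i • b.f i) * prodF b ρ l V := prodE_cons b.symm ρ i l V

theorem prodF_append (l l' : List ι) (V : ι → ℂ) :
    prodF b ρ (l ++ l') V = prodF b ρ l V * prodF b ρ l' V := prodE_append b.symm ρ l l' V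

theorem prodE_congr {l : List ι} {V V' : ι → ℂ} (h : ∀ i ∈ l, V i = V' i) :
    prodE b ρ l V = prodE b ρ l V' := by
  rw [prodE, prodE, List.map_congr_left fun i hi => by rw [h i hi]]

theorem prodE_mem_grpN (l : List ι) (V : ι → ℂ) : prodE b ρ l V ∈ grpN ρ b := by
  refine Subgroup.list_prod_mem _ fun x hx => ?_
  obtain ⟨i, -, rfl⟩ := List.mem_map.1 hx
  exact expG_e_mem_grpN b ρ _ _

theorem prodF_mem_grpNm (l : List ι) (V : ι → ℂ) : prodF b ρ l V ∈ grpNm ρ b :=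
  prodE_mem_grpN b.symm ρ l V

theorem prodE_inv (l : List ι) (V : ι → ℂ) :
    (prodE b ρ l V)⁻¹ = prodE b ρ l.reverse (-V) := by
  rw [prodE, List.prod_inv_reverse, prodE, List.map_reverse, List.map_map]
  simp only [Function.comp_def, ← expG_neg, Pi.neg_apply, neg_smul]

theorem prodF_inv (l : List ι) (V : ι → ℂ) :
    (prodF b ρ l V)⁻¹ = prodF b ρ l.reverse (-V) := prodE_inv b.symm ρ l V

theorem tor_mul_expG_e (c : ι → ℂ) (z : ℂ) (i : ι) :
    tor b ρ c * expG ρ (z • b.e i) =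
      expG ρ ((Complex.exp (rootEval b i c) * z) • b.e i) * tor b ρ c :=
  expG_mul_expG_of_lie_eq_smul ρ (lie_hSum_e b c i) z

theorem tor_mul_prodE (c : ι → ℂ) (l : List ι) (V : ι → ℂ) :
    tor b ρ c * prodE b ρ l V =
      prodE b ρ l (fun i => Complex.exp (rootEval b i c) * V i) * tor b ρ c := by
  induction l with
  | nil => simp
  | cons i l ih => rw [prodE_cons, ← mul_assoc, tor_mul_expG_e, mul_assoc, ih, prodE_cons, mul_assoc]

theorem tor_mul_prodF (c : ι → ℂ) (l : List ι) (V : ι → ℂ) :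
    tor b ρ c * prodF b ρ l V =
      prodF b ρ l (fun i => Complex.exp (-rootEval b i c) * V i) * tor b ρ c := by
  have := tor_mul_prodE b.symm ρ (-c) l V
  rw [tor_symm, neg_neg] at this
  simpa only [rootEval_symm, map_neg] using! this

theorem prodE_mul_tor (c : ι → ℂ) (l : List ι) (V : ι → ℂ) :
    prodE b ρ l V * tor b ρ c =
      tor b ρ c * prodE b ρ l (fun i => Complex.exp (-rootEval b i c) * V i) := by
  rw [tor_mul_prodE]
  simp only [← mul_assoc, ← Complex.exp_add, add_neg_cancel, Complex.exp_zero, one_mul]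

theorem commute_expG_e_expG_f {i j : ι} (h : i ≠ j) (x y : ℂ) :
    Commute (expG ρ (x • b.e i)) (expG ρ (y • b.f j)) :=
  commute_expG ρ (by rw [smul_lie, lie_smul, b.lie_e_f_ne i j h, smul_zero, smul_zero])

theorem commute_prodE_expG_f {l : List ι} {i : ι} (h : i ∉ l) (V : ι → ℂ) (y : ℂ) :
    Commute (prodE b ρ l V) (expG ρ (y • b.f i)) := by
  refine Commute.list_prod_left _ _ fun x hx => ?_
  obtain ⟨j, hj, rfl⟩ := List.mem_map.1 hx
  exact commute_expG_e_expG_f b ρ (fun hji : j = i => h (hji ▸ hj)) _ _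

theorem commute_prodF_expG_e {l : List ι} {i : ι} (h : i ∉ l) (V : ι → ℂ) (y : ℂ) :
    Commute (prodF b ρ l V) (expG ρ (y • b.e i)) :=
  commute_prodE_expG_f b.symm ρ h V y

theorem linearIndependent_e : LinearIndependent ℂ b.e := by
  classical
  rw [Fintype.linearIndependent_iff]
  intro g hg k
  obtain ⟨c, hc⟩ := exists_rootEval_eq b (Pi.single k 1)
  have h : ⁅hSum b c, ∑ i, g i • b.e i⁆ = g k • b.e k := by
    simp [lie_sum, lie_hSum_e, hc, Pi.single_apply]
  rw [hg, lie_zero] at h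
  exact (smul_eq_zero.1 h.symm).resolve_right (b.sl2 k).e_ne_zero

section Derivative

attribute [local instance] Matrix.linftyOpNormedRing Matrix.linftyOpNormedAlgebra

theorem hasDerivAt_prodE (l : List ι) (V : ι → ℂ) :
    HasDerivAt (fun z : ℂ => (prodE b ρ l (z • V) : Matrix (Fin n) (Fin n) ℂ))
      (ρ (l.map fun i => V i • b.e i).sum) 0 := by
  induction l with
  | nil =>
    simp only [prodE_nil, List.map_nil, List.sum_nil, map_zero]
    exact hasDerivAt_const (0 : ℂ) (1 : Matrix (Fin n) (Fin n) ℂ)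
  | cons i l ih =>
    have h0 : prodE b ρ l 0 = 1 := by simp [prodE]
    have h1 := hasDerivAt_exp_smul_comp (hasDerivAt_id (0 : ℂ)) (ρ (V i • b.e i))
    have h2 := h1.mul ih
    simp only [prodE_cons, Units.val_mul, coe_expG, Pi.smul_apply, smul_eq_mul, mul_smul,
      List.map_cons, List.sum_cons, map_smul, map_add] at h2 ⊢
    refine h2.congr_deriv ?_
    simp [h0]

/-- Conjugation by a torus element on which all simple roots take the value z replaces V by zV. The
product is thus known along a whole line, and its derivative at z = 0 is ∑ V_i x_i^+, whose terms
are linearly independent. -/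
theorem prodE_injective {l : List ι} (hl : l.Nodup) (hmem : ∀ i, i ∈ l)
    (hρ : Function.Injective ρ) {V V' : ι → ℂ} (h : prodE b ρ l V = prodE b ρ l V') : V = V' := by
  classical
  obtain ⟨c, hc⟩ := exists_rootEval_eq b fun _ => 1
  have key : ∀ V z, z ≠ 0 → prodE b ρ l (z • V) =
      tor b ρ (Complex.log z • c) * prodE b ρ l V * (tor b ρ (Complex.log z • c))⁻¹ := by
    intro V z hz
    rw [tor_mul_prodE, mul_inv_cancel_right]
    refine prodE_congr b ρ fun i _ => ?_
    rw [map_smul, hc, smul_eq_mul, mul_one, Complex.exp_log hz, Pi.smul_apply, smul_eq_mul]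
  have heq : ∀ z : ℂ, prodE b ρ l (z • V) = prodE b ρ l (z • V') := by
    intro z
    rcases eq_or_ne z 0 with rfl | hz
    · simp
    · rw [key V z hz, key V' z hz, h]
  have h1 := hasDerivAt_prodE b ρ l V
  simp only [heq] at h1
  have h2 := hρ (h1.unique (hasDerivAt_prodE b ρ l V'))
  have h3 : l.toFinset = Finset.univ := by ext i; simp [hmem]
  rw [← List.sum_toFinset _ hl, ← List.sum_toFinset _ hl, h3, ← sub_eq_zero,
    ← Finset.sum_sub_distrib] at h2
  simp only [← sub_smul] at h2
  exact funext fun i => sub_eq_zero.1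
    (Fintype.linearIndependent_iff.1 (linearIndependent_e b) _ h2 i)

end Derivative

theorem prodF_injective {l : List ι} (hl : l.Nodup) (hmem : ∀ i, i ∈ l)
    (hρ : Function.Injective ρ) {V V' : ι → ℂ} (h : prodF b ρ l V = prodF b ρ l V') : V = V' :=
  prodE_injective b.symm ρ hl hmem hρ h

/-- Root characters are functions on H, being the eigenvalues on the x_i^+, although `tor` is not
injective in its parameter. -/
theorem exp_rootEval_eq (hρ : Function.Injective ρ) {c c' : ι → ℂ}
    (h : tor b ρ c = tor b ρ c') (i : ι) :
    Complex.exp (rootEval b i c) = Complex.exp (rootEval b i c') := by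
  have key := fun c => conjMat_expG_of_lie_eq_smul ρ (lie_hSum_e b c i)
  have h1 := key c
  have h2 := key c'
  rw [← tor, h, tor, h2] at h1
  rw [← map_smul, ← map_smul] at h1
  exact (smul_left_injective ℂ (b.sl2 i).e_ne_zero (hρ h1)).symm

section SL2

attribute [local instance] Matrix.linftyOpNormedRing Matrix.linftyOpNormedAlgebra

theorem map_triple (i : ι) : ρ (b.e i) * ρ (b.f i) - ρ (b.f i) * ρ (b.e i) = ρ (b.h i) ∧
    ρ (b.h i) * ρ (b.e i) - ρ (b.e i) * ρ (b.h i) = (2 : ℂ) • ρ (b.e i) ∧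
    ρ (b.h i) * ρ (b.f i) - ρ (b.f i) * ρ (b.h i) = -((2 : ℂ) • ρ (b.f i)) := by
  refine ⟨?_, ?_, ?_⟩
  · rw [← map_lie_eq, (b.sl2 i).lie_e_f]
  · rw [← map_lie_eq, (b.sl2 i).lie_h_e_nsmul, two_smul ℂ, two_nsmul, map_add]
  · rw [← map_lie_eq, (b.sl2 i).lie_h_f_nsmul, two_smul ℂ, two_nsmul, map_neg, map_add]

theorem expG_e_mul_expG_f (i : ι) {β γ s : ℂ} (hβ : β ≠ 0) (hs : Complex.exp s = 1 + β * γ) :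
    expG ρ (β • b.e i) * expG ρ (γ • b.f i) = expG ρ ((γ * Complex.exp (-s)) • b.f i) *
      expG ρ (s • b.h i) * expG ρ ((β * Complex.exp (-s)) • b.e i) := by
  obtain ⟨h1, h2, h3⟩ := map_triple b ρ i
  ext1
  simp only [Units.val_mul, coe_expG, map_smul]
  exact exp_raise_mul_exp_lower h1 h2 h3 hβ hs

theorem expG_two_pi_I_smul_h (i : ι) : expG ρ ((2 * Real.pi * Complex.I : ℂ) • b.h i) = 1 := by
  obtain ⟨h1, h2, h3⟩ := map_triple b ρ i
  ext1
  simp only [coe_expG, map_smul]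
  exact exp_two_pi_I_smul_cartan h1 h2 h3

theorem conjMat_expG_e_f (i : ι) (t : ℂ) :
    conjMat (expG ρ (t • b.e i)) (ρ (b.f i)) = ρ (b.f i) + t • ρ (b.h i) - t ^ 2 • ρ (b.e i) := by
  obtain ⟨h1, h2, -⟩ := map_triple b ρ i
  rw [← inv_inv (expG ρ (t • b.e i)), ← expG_neg, ← neg_smul]
  refine (conjMat_inv_eq_of_mul_eq
    (M' := ρ (b.f i) - (-t) • ρ (b.h i) - (-t) ^ 2 • ρ (b.e i)) ?_).trans ?_
  · simp only [coe_expG, map_smul]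
    exact lower_mul_exp_raise h1 h2 (-t)
  · module

theorem conjMat_expG_e_h (i : ι) (t : ℂ) :
    conjMat (expG ρ (t • b.e i)) (ρ (b.h i)) = ρ (b.h i) - (2 * t) • ρ (b.e i) := by
  obtain ⟨-, h2, -⟩ := map_triple b ρ i
  rw [← inv_inv (expG ρ (t • b.e i)), ← expG_neg, ← neg_smul]
  refine (conjMat_inv_eq_of_mul_eq
    (M' := ρ (b.h i) + (2 * (-t)) • ρ (b.e i)) ?_).trans ?_
  · simp only [coe_expG, map_smul]
    exact cartan_mul_exp_raise h2 (-t)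
  · module

end SL2

/-- The branch of the logarithm does not matter, because exp(2πi h_i) = 1. -/
theorem tor_log_exp (a : ι → ℂ) : tor b ρ (fun i => Complex.log (Complex.exp (a i))) = tor b ρ a := by
  classical
  have hk : ∀ i, ∃ k : ℤ, Complex.log (Complex.exp (a i)) = a i + k * (2 * Real.pi * Complex.I) :=
    fun i => Complex.exp_eq_exp_iff_exists_int.1 (Complex.exp_log (Complex.exp_ne_zero _))
  choose k hk using hk
  have h1 : ∀ i (m : ℤ), expG ρ ((m : ℂ) • (2 * Real.pi * Complex.I : ℂ) • b.h i) = 1 := by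
    intro i m
    ext1
    have := congrArg (fun g : GL (Fin n) ℂ => (g : Matrix (Fin n) (Fin n) ℂ))
      (expG_two_pi_I_smul_h b ρ i)
    simp only [coe_expG] at this ⊢
    rw [Int.cast_smul_eq_zsmul, map_zsmul, Matrix.exp_zsmul, this]
    simp
  have h2 : ∀ s : Finset ι, tor b ρ (∑ i ∈ s, Pi.single i (k i * (2 * Real.pi * Complex.I))) = 1 := by
    intro s
    induction s using Finset.induction_on with
    | empty => simp
    | insert i s hi ih =>
      rw [Finset.sum_insert hi, tor_add, ih, mul_one, tor, hSum_single, mul_smul, h1]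
  have h3 : (fun i => Complex.log (Complex.exp (a i))) =
      a + ∑ i, Pi.single i (k i * (2 * Real.pi * Complex.I)) := by
    rw [Finset.univ_sum_single fun i => (k i * (2 * Real.pi * Complex.I) : ℂ)]
    exact funext hk
  rw [h3, tor_add, h2, mul_one]

end OrderedProducts

/-! ### Reversing the order of upper and lower factors -/

section Factorization

variable {𝔤 : Type*} [LieRing 𝔤] [LieAlgebra ℂ 𝔤] {n : ℕ}
  {ι : Type*} [Fintype ι] {𝔥 : LieSubalgebra ℂ 𝔤} (b : LieAlgebra.Basis ι 𝔥)
  (ρ : 𝔤 →ₗ⁅ℂ⁆ Matrix (Fin n) (Fin n) ℂ)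

theorem A_diag (i : ι) : b.A i i = 2 := by
  have h := b.lie_h_e i i
  rw [(b.sl2 i).lie_h_e_nsmul, two_nsmul, ← two_smul ℂ, ← Int.cast_smul_eq_zsmul ℂ] at h
  exact_mod_cast (smul_left_injective ℂ (b.sl2 i).e_ne_zero h).symm

theorem expG_e_mul_tor (c : ι → ℂ) (z : ℂ) (i : ι) :
    expG ρ (z • b.e i) * tor b ρ c =
      tor b ρ c * expG ρ ((Complex.exp (-rootEval b i c) * z) • b.e i) := by
  simpa [prodE] using prodE_mul_tor b ρ c [i] fun _ => z

theorem prodE_update [DecidableEq ι] {l : List ι} {i : ι} (hi : i ∉ l) (V : ι → ℂ) (z : ℂ) :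
    prodE b ρ l (Function.update V i z) = prodE b ρ l V :=
  prodE_congr b ρ fun j hj => Function.update_of_ne (fun h : j = i => hi (h ▸ hj)) _ _

theorem prodF_update [DecidableEq ι] {l : List ι} {i : ι} (hi : i ∉ l) (V : ι → ℂ) (z : ℂ) :
    prodF b ρ l (Function.update V i z) = prodF b ρ l V := prodE_update b.symm ρ hi V z

/-- The factorization of `∏ exp (V_i x_i^+) ∏ exp (γ_i x_i^-)` in the opposite order. -/
theorem exists_prodE_mul_prodF_eq [DecidableEq ι] {l : List ι} (hl : l.Nodup) {V γ s : ι → ℂ}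
    (hV : ∀ i ∈ l, V i ≠ 0) (hs : ∀ i ∈ l, Complex.exp (s i) = 1 + V i * γ i) :
    ∃ γ' V' : ι → ℂ, prodE b ρ l V * prodF b ρ l γ =
      prodF b ρ l γ' * tor b ρ (l.map fun i => Pi.single i (s i)).sum * prodE b ρ l V' ∧
      ∀ k ∈ l, V' k * γ' k = V k * γ k *
        Complex.exp (-rootEval b k (l.map fun i => Pi.single i (s i)).sum) ∧ V' k ≠ 0 := by
  induction l with
  | nil => exact ⟨γ, V, by simp, by simp⟩
  | cons i l ih =>
    obtain ⟨hi, hl⟩ := List.nodup_cons.1 hl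
    obtain ⟨γ', V', h, hk⟩ := ih hl (fun j hj => hV j (List.mem_cons_of_mem _ hj))
      (fun j hj => hs j (List.mem_cons_of_mem _ hj))
    set σ := (l.map fun i => (Pi.single i (s i) : ι → ℂ)).sum with hσ
    -- The entries at i come from the SL₂ identity; the exponential root factors arise when the two
    -- torus parts are merged in the middle. Only the products V'_k γ'_k are recorded, as χ depends
    -- on nothing else.
    refine ⟨Function.update
        (fun j => Complex.exp (-rootEval b j (Pi.single i (s i))) * γ' j) i
          (γ i * Complex.exp (-s i)),
      Function.update V' i
        (Complex.exp (-rootEval b i σ) * (V i * Complex.exp (-s i))), ?_, ?_⟩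
    · rw [prodE_cons, prodF_cons, prodE_cons, prodF_cons, prodE_update b ρ hi,
        prodF_update b ρ hi, Function.update_self, Function.update_self, List.map_cons,
        List.sum_cons, ← hσ, tor_add]
      have e1 := expG_e_mul_expG_f b ρ i (hV i List.mem_cons_self) (hs i List.mem_cons_self)
      have e2 := (commute_prodE_expG_f b ρ hi V (γ i)).eq
      have e3 := tor_mul_prodF b ρ (Pi.single i (s i)) l γ'
      have e4 := expG_e_mul_tor b ρ σ (V i * Complex.exp (-s i)) i
      have e5 := (commute_prodF_expG_e b ρ hi γ' (V i * Complex.exp (-s i))).eq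
      have e6 : tor b ρ (Pi.single i (s i)) = expG ρ (s i • b.h i) := by rw [tor, hSum_single]
      rw [← e6] at e1
      calc _ = expG ρ (V i • b.e i) * (prodE b ρ l V * expG ρ (γ i • b.f i)) * prodF b ρ l γ := by
            simp only [mul_assoc]
        _ = (expG ρ (V i • b.e i) * expG ρ (γ i • b.f i)) * (prodE b ρ l V * prodF b ρ l γ) := by
            rw [e2]; simp only [mul_assoc]
        _ = expG ρ ((γ i * Complex.exp (-s i)) • b.f i) * tor b ρ (Pi.single i (s i)) *
            (expG ρ ((V i * Complex.exp (-s i)) • b.e i) * prodF b ρ l γ') * tor b ρ σ *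
              prodE b ρ l V' := by
            rw [e1, h]; simp only [mul_assoc]
        _ = expG ρ ((γ i * Complex.exp (-s i)) • b.f i) *
            (tor b ρ (Pi.single i (s i)) * prodF b ρ l γ') *
            (expG ρ ((V i * Complex.exp (-s i)) • b.e i) * tor b ρ σ) * prodE b ρ l V' := by
            rw [← e5]; simp only [mul_assoc]
        _ = _ := by rw [e3, e4]; simp only [mul_assoc]
    · intro k hkl
      rw [List.map_cons, List.sum_cons, ← hσ, map_add, neg_add, Complex.exp_add]
      by_cases hki : k = i
      · subst hki
        refine ⟨?_, by
          rw [Function.update_self]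
          exact mul_ne_zero (Complex.exp_ne_zero _)
            (mul_ne_zero (hV k List.mem_cons_self) (Complex.exp_ne_zero _))⟩
        -- The two factors exp(-s_k) of the SL₂ identity combine into the root character, since
        -- α_k(h_k) = 2.
        rw [Function.update_self, Function.update_self, rootEval_single, A_diag b,
          show -(s k * ((2 : ℤ) : ℂ)) = -s k + -s k by push_cast; ring, Complex.exp_add]
        ring
      · obtain ⟨hk1, hk2⟩ := hk k ((List.mem_cons.1 hkl).resolve_left hki)
        rw [Function.update_of_ne hki, Function.update_of_ne hki, mul_left_comm, hk1]
        refine ⟨?_, hk2⟩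
        ring

end Factorization

/-! ### Necessity of χ⁻_k ≠ 1: growth under a fundamental coweight -/

section Domain

open Filter Topology

variable {𝔤 : Type*} [LieRing 𝔤] [LieAlgebra ℂ 𝔤] {n : ℕ}
  {ι : Type*} [Fintype ι] {𝔥 : LieSubalgebra ℂ 𝔤} (b : LieAlgebra.Basis ι 𝔥)
  (ρ : 𝔤 →ₗ⁅ℂ⁆ Matrix (Fin n) (Fin n) ℂ) (c : ι → ℂ)

/-- The matrices growing slower than `e ^ s` under conjugation by `exp (s ∑ c_j h_j)`. -/
def slowMat : Submodule ℂ (Matrix (Fin n) (Fin n) ℂ) where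
  carrier := {M | Tendsto (fun s : ℝ => Complex.exp (-(s : ℂ)) • conjMat (tor b ρ ((s : ℂ) • c)) M)
    atTop (𝓝 0)}
  add_mem' := by
    intro M M' h h'
    simpa only [Set.mem_ofPred_eq, map_add, smul_add, add_zero] using h.add h'
  zero_mem' := by simp
  smul_mem' := by
    intro t M h
    simpa only [Set.mem_ofPred_eq, map_smul, smul_zero, smul_comm t] using h.const_smul t

/-- The elements converging, together with their inverse, under conjugation by
`exp (s ∑ c_j h_j)`. -/
def convGrp : Subgroup (GL (Fin n) ℂ) where
  carrier := {g | (∃ M, Tendsto (fun s : ℝ => conjMat (tor b ρ ((s : ℂ) • c)) g) atTop (𝓝 M)) ∧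
    ∃ M, Tendsto (fun s : ℝ => conjMat (tor b ρ ((s : ℂ) • c)) (g⁻¹ : GL (Fin n) ℂ)) atTop (𝓝 M)}
  mul_mem' := by
    rintro g k ⟨⟨M1, h1⟩, ⟨M2, h2⟩⟩ ⟨⟨M3, h3⟩, ⟨M4, h4⟩⟩
    refine ⟨⟨M1 * M3, ?_⟩, ⟨M4 * M2, ?_⟩⟩
    · simpa only [Units.val_mul, conjMat_map_mul] using h1.mul h3
    · simpa only [_root_.mul_inv_rev, Units.val_mul, conjMat_map_mul] using h4.mul h2
  one_mem' := by
    constructor <;> exact ⟨1, by simp [conjMat_apply]⟩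
  inv_mem' := by
    rintro g ⟨h1, h2⟩
    exact ⟨h2, by simpa using h1⟩

variable {b ρ c}

theorem conjMat_mem_slowMat {g : GL (Fin n) ℂ} (hg : g ∈ convGrp b ρ c)
    {M : Matrix (Fin n) (Fin n) ℂ} (hM : M ∈ slowMat b ρ c) : conjMat g M ∈ slowMat b ρ c := by
  obtain ⟨⟨M1, h1⟩, ⟨M2, h2⟩⟩ := hg
  have h := (h1.mul hM).mul h2
  rw [mul_zero, zero_mul] at h
  refine Tendsto.congr (fun s => ?_) h
  rw [conjMat_apply g, conjMat_map_mul, conjMat_map_mul, mul_smul_comm, smul_mul_assoc]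

theorem mem_convGrp_of_commute {g : GL (Fin n) ℂ}
    (h : ∀ s : ℝ, Commute (tor b ρ ((s : ℂ) • c)) g) : g ∈ convGrp b ρ c := by
  constructor
  · refine ⟨g, ?_⟩
    simp only [conjMat_coe, (h _).eq, mul_inv_cancel_right]
    exact tendsto_const_nhds
  · refine ⟨(g⁻¹ : GL (Fin n) ℂ), ?_⟩
    simp only [conjMat_coe, ((h _).inv_right).eq, mul_inv_cancel_right]
    exact tendsto_const_nhds

theorem mem_slowMat_of_lie_eq_smul {m : 𝔤} {μ : ℝ} (hμ : μ < 1)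
    (h : ⁅hSum b c, m⁆ = (μ : ℂ) • m) : ρ m ∈ slowMat b ρ c := by
  have h1 : ∀ s : ℝ, Complex.exp (-(s : ℂ)) • conjMat (tor b ρ ((s : ℂ) • c)) (ρ m) =
      ((Real.exp ((μ - 1) * s) : ℝ) : ℂ) • ρ m := by
    intro s
    rw [tor, map_smul, conjMat_expG_of_lie_eq_smul ρ (c := s * μ) (by rw [smul_lie, h, smul_smul]),
      smul_smul, ← Complex.exp_add, Complex.ofReal_exp]
    congr 2
    push_cast
    ring
  have h2 : Tendsto (fun s : ℝ => (μ - 1) * s) atTop atBot :=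
    tendsto_id.const_mul_atTop_of_neg (by linarith)
  have h3 := ((Complex.continuous_ofReal.tendsto 0).comp
    (Real.tendsto_exp_atBot.comp h2)).smul_const (ρ m)
  rw [Complex.ofReal_zero, zero_smul] at h3
  exact h3.congr fun s => (h1 s).symm

theorem eq_zero_of_mem_slowMat {m : 𝔤} (h : ⁅hSum b c, m⁆ = m) (hm : ρ m ∈ slowMat b ρ c) :
    ρ m = 0 := by
  have h1 : ∀ s : ℝ, Complex.exp (-(s : ℂ)) • conjMat (tor b ρ ((s : ℂ) • c)) (ρ m) = ρ m := by
    intro s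
    rw [tor, map_smul, conjMat_expG_of_lie_eq_smul ρ (c := s) (by rw [smul_lie, h]),
      smul_smul, ← Complex.exp_add, neg_add_cancel, Complex.exp_zero, one_smul]
  have h2 : Tendsto (fun s : ℝ => Complex.exp (-(s : ℂ)) • conjMat (tor b ρ ((s : ℂ) • c)) (ρ m))
    atTop (𝓝 0) := hm
  simp only [h1] at h2
  exact tendsto_nhds_unique tendsto_const_nhds h2

variable {k : ι}

/-- For j ≠ k the factor commutes with the coweight flow; for j = k it is contracted to 1, as x_k^-
has weight -1. -/
theorem expG_f_mem_convGrp [DecidableEq ι] (hc : ∀ j, rootEval b j c = (Pi.single k 1 : ι → ℂ) j)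
    (z : ℂ) (j : ι) : expG ρ (z • b.f j) ∈ convGrp b ρ c := by
  by_cases hj : j = k
  · subst hj
    have key : ∀ z : ℂ, Tendsto
        (fun s : ℝ => conjMat (tor b ρ ((s : ℂ) • c)) (expG ρ (z • b.f j))) atTop (𝓝 1) := by
      intro z
      have h1 : ∀ s : ℝ, conjMat (tor b ρ ((s : ℂ) • c)) (expG ρ (z • b.f j)) =
          expG ρ ((((Real.exp (-s) : ℝ) : ℂ) * z) • b.f j) := by
        intro s
        have := tor_mul_prodF b ρ ((s : ℂ) • c) [j] fun _ => z
        rw [← mul_inv_eq_iff_eq_mul] at this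
        simp only [prodF_cons, prodF_nil, mul_one] at this
        rw [conjMat_coe, this, map_smul, hc, Pi.single_eq_same, smul_eq_mul, mul_one,
          Complex.ofReal_exp, Complex.ofReal_neg]
      have h2 : Continuous fun t : ℂ => expG ρ ((t * z) • b.f j) := by
        refine continuous_expG_comp ρ ?_
        simp only [map_smul]
        fun_prop
      have h3 := (Units.continuous_val.comp h2).tendsto 0
      simp only [Function.comp_def, zero_mul, zero_smul, expG_zero, Units.val_one] at h3
      have h4 := h3.comp ((Complex.continuous_ofReal.tendsto 0).comp
        (Real.tendsto_exp_atBot.comp tendsto_neg_atTop_atBot))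
      exact h4.congr fun s => (h1 s).symm
    exact ⟨⟨1, key z⟩, ⟨1, by rw [← expG_neg, ← neg_smul]; exact key _⟩⟩
  · refine mem_convGrp_of_commute fun s => commute_expG ρ ?_
    rw [lie_smul, lie_hSum_f, map_smul, hc, Pi.single_eq_of_ne hj]
    simp

theorem expG_e_mem_convGrp [DecidableEq ι] (hc : ∀ j, rootEval b j c = (Pi.single k 1 : ι → ℂ) j)
    (z : ℂ) {j : ι} (hj : j ≠ k) : expG ρ (z • b.e j) ∈ convGrp b ρ c := by
  refine mem_convGrp_of_commute fun s => commute_expG ρ ?_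
  rw [lie_smul, lie_hSum_e, map_smul, hc, Pi.single_eq_of_ne hj]
  simp

theorem prodF_mem_convGrp [DecidableEq ι] (hc : ∀ j, rootEval b j c = (Pi.single k 1 : ι → ℂ) j)
    (l : List ι) (V : ι → ℂ) : prodF b ρ l V ∈ convGrp b ρ c := by
  refine Subgroup.list_prod_mem _ fun x hx => ?_
  obtain ⟨i, -, rfl⟩ := List.mem_map.1 hx
  exact expG_f_mem_convGrp hc _ _

theorem prodE_mem_convGrp [DecidableEq ι] (hc : ∀ j, rootEval b j c = (Pi.single k 1 : ι → ℂ) j)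
    {l : List ι} (hl : k ∉ l) (V : ι → ℂ) : prodE b ρ l V ∈ convGrp b ρ c := by
  refine Subgroup.list_prod_mem _ fun x hx => ?_
  obtain ⟨i, hi, rfl⟩ := List.mem_map.1 hx
  exact expG_e_mem_convGrp hc _ fun h : i = k => hl (h ▸ hi)

variable (b ρ)

theorem conjMat_prodE_of_lie_eq_zero {l : List ι} {m : 𝔤} (h : ∀ j ∈ l, ⁅b.e j, m⁆ = 0)
    (V : ι → ℂ) : conjMat (prodE b ρ l V) (ρ m) = ρ m := by
  induction l with
  | nil => simp
  | cons i l ih =>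
    rw [prodE_cons, conjMat_mul, ih fun j hj => h j (List.mem_cons_of_mem _ hj),
      conjMat_expG_of_lie_eq_zero ρ (by rw [smul_lie, h i List.mem_cons_self, smul_zero])]

/-- The element ∑ c_j h_j - h_k/2 commutes with x_k^+, so only h_k/2 moves, by the SL₂ formula. -/
theorem conjMat_expG_e_hSum (k : ι) (hk : rootEval b k c = 1) (t : ℂ) :
    conjMat (expG ρ (t • b.e k)) (ρ (hSum b c)) = ρ (hSum b c) - t • ρ (b.e k) := by
  have h1 : ⁅t • b.e k, hSum b c - (2⁻¹ : ℂ) • b.h k⁆ = 0 := by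
    rw [smul_lie, lie_sub, lie_smul, ← lie_skew, ← lie_skew (b.e k) (b.h k), lie_hSum_e, hk,
      (b.sl2 k).lie_h_e_nsmul]
    module
  have h2 := conjMat_expG_of_lie_eq_zero ρ h1
  have h3 := conjMat_expG_e_h b ρ k t
  rw [map_sub, map_sub, map_smul, map_smul, h3] at h2
  rw [sub_eq_iff_eq_add.1 h2]
  module

theorem conjMat_expG_f_hSum (k : ι) (hk : rootEval b k c = 1) (t : ℂ) :
    conjMat (expG ρ (t • b.f k)) (ρ (hSum b c)) = ρ (hSum b c) + t • ρ (b.f k) := by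
  have h := conjMat_expG_e_hSum b.symm ρ (c := c) k hk t
  rw [hSum_symm, map_neg, map_neg, map_neg] at h
  rw [← neg_inj]
  refine h.trans ?_
  change _ - t • ρ (b.f k) = _
  abel

theorem lie_e_hSum (j : ι) : ⁅b.e j, hSum b c⁆ = -(rootEval b j c • b.e j) := by
  rw [← lie_skew, lie_hSum_e]

/-- If `∏ exp (V_i x_i^+) ∏ exp (γ_i x_i^-)` can be factorized in the opposite order, then
`1 + V_k γ_k ≠ 0`. -/
theorem one_add_mul_ne_zero (hρ : Function.Injective ρ) {l : List ι} (hl : l.Nodup) (hk : k ∈ l)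
    {V γ V' γ' d d' : ι → ℂ} (hV' : V' k ≠ 0)
    (h : prodE b ρ l V * prodF b ρ l γ * tor b ρ d = prodF b ρ l γ' * prodE b ρ l V' * tor b ρ d') :
    1 + V k * γ k ≠ 0 := by
  classical
  intro h0
  -- The k-th fundamental coweight is conjugated by both sides. Only x_k^+, of weight 1, is not
  -- slow, and the factors other than exp(V_k x_k^+) preserve slowness.
  obtain ⟨c, hc⟩ := exists_rootEval_eq b (Pi.single k 1)
  obtain ⟨l₁, l₂, rfl⟩ := List.append_of_mem hk
  have hnd := List.nodup_append.1 hl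
  have hk2 : k ∉ l₂ := (List.nodup_cons.1 hnd.2.1).1
  have hk1 : k ∉ l₁ := fun hk1 => hnd.2.2 k hk1 k List.mem_cons_self rfl
  have h12 : ∀ j ∈ l₂, j ∉ l₁ := fun j hj hj1 =>
    hnd.2.2 j hj1 j (List.mem_cons_of_mem _ hj) rfl
  have hck : rootEval b k c = 1 := by rw [hc, Pi.single_eq_same]
  have hcj : ∀ j ∈ l₂, rootEval b j c = 0 := fun j hj => by
    rw [hc, Pi.single_eq_of_ne]
    rintro rfl
    exact hk2 hj
  have hEx : ∀ V, conjMat (prodE b ρ l₂ V) (ρ (hSum b c)) = ρ (hSum b c) :=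
    conjMat_prodE_of_lie_eq_zero b ρ fun j hj => by rw [lie_e_hSum, hcj j hj, zero_smul, neg_zero]
  have hFx : ∀ V, conjMat (prodF b ρ l₂ V) (ρ (hSum b c)) = ρ (hSum b c) := by
    intro V
    have := conjMat_prodE_of_lie_eq_zero b.symm ρ (l := l₂) (m := hSum b.symm (-c)) (fun j hj => by
      rw [lie_e_hSum, map_neg, rootEval_symm, hcj j hj, neg_zero, zero_smul, neg_zero]) V
    rwa [hSum_symm, neg_neg] at this
  have hEf : ∀ V, conjMat (prodE b ρ l₂ V) (ρ (b.f k)) = ρ (b.f k) :=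
    conjMat_prodE_of_lie_eq_zero b ρ fun j hj =>
      b.lie_e_f_ne j k fun hjk => hk2 (hjk ▸ hj)
  have htx : ∀ d, conjMat (tor b ρ d) (ρ (hSum b c)) = ρ (hSum b c) := fun d =>
    conjMat_expG_of_lie_eq_zero ρ (lie_hSum_hSum b d c)
  have hx : ρ (hSum b c) ∈ slowMat b ρ c :=
    mem_slowMat_of_lie_eq_smul (μ := 0) (by norm_num) (by rw [lie_hSum_hSum]; simp)
  have hf : ρ (b.f k) ∈ slowMat b ρ c :=
    mem_slowMat_of_lie_eq_smul (μ := -1) (by norm_num) (by rw [lie_hSum_f, hck]; simp)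
  have hh : ρ (b.h k) ∈ slowMat b ρ c :=
    mem_slowMat_of_lie_eq_smul (μ := 0) (by norm_num) (by
      have := lie_hSum_hSum b c (Pi.single k 1)
      rw [hSum_single, one_smul] at this
      rw [this]; simp)
  -- The lower factors from l₁ pass the upper factors at k and in l₂, because the indices are
  -- distinct.
  have hcomm : prodE b ρ (l₁ ++ k :: l₂) V * prodF b ρ l₁ γ =
      prodE b ρ l₁ V * prodF b ρ l₁ γ * (expG ρ (V k • b.e k) * prodE b ρ l₂ V) := by
    have e1 : Commute (prodF b ρ l₁ γ) (prodE b ρ l₂ V) := by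
      refine Commute.list_prod_right _ _ fun x hx => ?_
      obtain ⟨j, hj, rfl⟩ := List.mem_map.1 hx
      exact commute_prodF_expG_e b ρ (h12 j hj) _ _
    have e2 := (commute_prodF_expG_e b ρ hk1 γ (V k)).mul_right e1
    rw [prodE_append, prodE_cons, mul_assoc, ← e2.eq, mul_assoc]
  have hL : conjMat (prodE b ρ (l₁ ++ k :: l₂) V * prodF b ρ (l₁ ++ k :: l₂) γ * tor b ρ d)
      (ρ (hSum b c)) ∈ slowMat b ρ c := by
    rw [prodF_append, prodF_cons, ← mul_assoc, hcomm]
    simp only [conjMat_mul]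
    rw [htx, hFx, conjMat_expG_f_hSum b ρ k hck, map_add, map_smul, hEx, hEf, map_add, map_smul,
      conjMat_expG_e_hSum b ρ k hck, conjMat_expG_e_f]
    refine conjMat_mem_slowMat (prodE_mem_convGrp hc hk1 _)
      (conjMat_mem_slowMat (prodF_mem_convGrp hc _ _) ?_)
    have : ρ (hSum b c) - V k • ρ (b.e k) +
        γ k • (ρ (b.f k) + V k • ρ (b.h k) - V k ^ 2 • ρ (b.e k)) =
        ρ (hSum b c) + γ k • ρ (b.f k) + (γ k * V k) • ρ (b.h k) -
          (V k * (1 + V k * γ k)) • ρ (b.e k) := by module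
    -- The coefficient of x_k^+ is -V_k(1 + V_k γ_k), so the left side is slow.
    rw [this, h0, mul_zero, zero_smul, sub_zero]
    exact add_mem (add_mem hx (Submodule.smul_mem _ _ hf)) (Submodule.smul_mem _ _ hh)
  rw [h, prodE_append, prodE_cons] at hL
  simp only [conjMat_mul] at hL
  rw [htx, hEx, conjMat_expG_e_hSum b ρ k hck] at hL
  have h1 := conjMat_mem_slowMat (inv_mem (prodF_mem_convGrp hc (l₁ ++ k :: l₂) γ')) hL
  rw [conjMat_inv_conjMat] at h1
  have h2 := conjMat_mem_slowMat (inv_mem (prodE_mem_convGrp hc hk1 V')) h1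
  rw [conjMat_inv_conjMat] at h2
  -- The right side contributes -V'_k x_k^+ with V'_k ≠ 0, which makes x_k^+ itself slow and hence
  -- zero.
  have h3 : ρ (b.e k) ∈ slowMat b ρ c := by
    have := Submodule.smul_mem _ (V' k)⁻¹ (sub_mem hx h2)
    rwa [sub_sub_cancel, smul_smul, inv_mul_cancel₀ hV', one_smul] at this
  have h4 := eq_zero_of_mem_slowMat (by rw [lie_hSum_e, hck, one_smul]) h3
  exact (b.sl2 k).e_ne_zero (hρ (h4.trans (map_zero ρ).symm))

end Domain

/-! ### The chart lies in a single symplectic leaf -/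

section Leaf

variable {𝔤 : Type*} [LieRing 𝔤] [LieAlgebra ℂ 𝔤] {n : ℕ}
  {ι : Type*} [Fintype ι] {𝔥 : LieSubalgebra ℂ 𝔤} (b : LieAlgebra.Basis ι 𝔥)
  (ρ : 𝔤 →ₗ⁅ℂ⁆ Matrix (Fin n) (Fin n) ℂ)

theorem list_sum_single [DecidableEq ι] {l : List ι} (hl : l.Nodup) (hmem : ∀ i, i ∈ l)
    (s : ι → ℂ) : (l.map fun i => (Pi.single i (s i) : ι → ℂ)).sum = s := by
  have : l.toFinset = Finset.univ := by ext i; simp [hmem]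
  rw [← List.sum_toFinset _ hl, this, Finset.univ_sum_single]

/-- The factorization of `∏ exp (V_i x_i^+) ∏ exp (γ_i x_i^-)` in the opposite order, for a product
over all simple roots. -/
theorem exists_prodE_mul_prodF_eq_of_forall_mem {l : List ι} (hl : l.Nodup) (hmem : ∀ i, i ∈ l)
    {V γ s : ι → ℂ} (hV : ∀ i, V i ≠ 0) (hs : ∀ i, Complex.exp (s i) = 1 + V i * γ i) :
    ∃ γ' V' : ι → ℂ, prodE b ρ l V * prodF b ρ l γ =
      prodF b ρ l γ' * tor b ρ s * prodE b ρ l V' ∧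
      ∀ k, V' k * γ' k = V k * γ k * Complex.exp (-rootEval b k s) ∧ V' k ≠ 0 := by
  classical
  obtain ⟨γ', V', h1, h2⟩ :=
    exists_prodE_mul_prodF_eq b ρ hl (fun i _ => hV i) (fun i _ => hs i)
  rw [list_sum_single hl hmem] at h1 h2
  exact ⟨γ', V', h1, fun k => h2 k (hmem k)⟩

/-- All the elements `∏ exp (V_i x_i^+) t` with `V_i ≠ 0` are in one orbit of `B⁻ × B⁻`. -/
theorem exists_prodE_mul_tor_eq {l : List ι} (hl : l.Nodup) (hmem : ∀ i, i ∈ l)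
    {V V' a a' : ι → ℂ} (hV : ∀ i, V i ≠ 0) (hV' : ∀ i, V' i ≠ 0) :
    ∃ p ∈ grpBm ρ b, ∃ q ∈ grpBm ρ b,
      prodE b ρ l V' * tor b ρ a' = p * (prodE b ρ l V * tor b ρ a) * q ∧
      tor b ρ a' = (thetam ρ b p)⁻¹ * tor b ρ a * (thetam ρ b q)⁻¹ := by
  -- Let p and q have torus parameters s and u - a. Matching the products requires s + δ + u = a',
  -- matching the H-components requires 2a - s - u = a'; together they force δ = 2(a' - a). The
  -- lower factor of q is chosen so that reversing it past E(V) creates the torus element δ.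
  set δ : ι → ℂ := 2 • (a' - a) with hδ
  obtain ⟨γ', V₁, h1, h2⟩ := exists_prodE_mul_prodF_eq_of_forall_mem b ρ hl hmem (s := δ)
    (γ := fun i => (Complex.exp (δ i) - 1) / V i) hV fun i => by
      rw [mul_div_cancel₀ _ (hV i)]; ring
  obtain ⟨s, hs⟩ := exists_rootEval_eq b fun k => Complex.log (V' k / V₁ k) - rootEval b k δ
  have hF := fun γ => prodF_mem_grpNm b ρ l γ
  set y := fun i => (Complex.exp (δ i) - 1) / V i
  refine ⟨tor b ρ s * (prodF b ρ l γ')⁻¹,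
    mul_mem (tor_mem_grpBm b ρ _) (inv_mem (grpNm_le_grpBm b ρ (hF _))),
    tor b ρ (-a) * prodF b ρ l y * tor b ρ (2 • a - a' - s),
    mul_mem (mul_mem (tor_mem_grpBm b ρ _) (grpNm_le_grpBm b ρ (hF _))) (tor_mem_grpBm b ρ _),
    ?_, ?_⟩
  · have e1 : prodE b ρ l V' * tor b ρ (s + δ) = tor b ρ (s + δ) * prodE b ρ l V₁ := by
      rw [tor_mul_prodE]
      congr 1
      refine prodE_congr b ρ fun i _ => ?_
      rw [map_add, hs, sub_add_cancel, Complex.exp_log (div_ne_zero (hV' i) (h2 i).2),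
        div_mul_cancel₀ _ (h2 i).2]
    have e2 : a' = s + δ + (2 • a - a' - s) := by rw [hδ]; module
    calc _ = tor b ρ (s + δ) * prodE b ρ l V₁ * tor b ρ (2 • a - a' - s) := by
          conv_lhs => rw [e2, tor_add, ← mul_assoc, e1]
      _ = tor b ρ s * (prodF b ρ l γ')⁻¹ * (prodF b ρ l γ' * tor b ρ δ * prodE b ρ l V₁) *
          tor b ρ (2 • a - a' - s) := by
          rw [tor_add]; group
      _ = _ := by rw [← h1, tor_neg]; group
  · rw [thetam_mul b ρ (tor_mem_grpBm b ρ _) (inv_mem (grpNm_le_grpBm b ρ (hF _))),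
      thetam_mul b ρ (mul_mem (tor_mem_grpBm b ρ _) (grpNm_le_grpBm b ρ (hF _)))
        (tor_mem_grpBm b ρ _), thetam_mul b ρ (tor_mem_grpBm b ρ _) (grpNm_le_grpBm b ρ (hF _)),
      thetam_of_mem_grpNm b ρ (inv_mem (hF _)), thetam_of_mem_grpNm b ρ (hF _), thetam_tor,
      thetam_tor, thetam_tor, mul_one, mul_one, ← tor_add, ← tor_neg, ← tor_neg, ← tor_add,
      ← tor_add]
    congr 1
    module

/-- The point `I(U, L)` for `U = ∏ exp (V_i x_i^+) exp a` and `L = ∏ exp (W_i x_i^-) exp d`. -/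
def chartPt (l : List ι) (V W a d : ι → ℂ) : Amb n :=
  (prodE b ρ l V * tor b ρ a * (prodF b ρ l.reverse W * tor b ρ d)⁻¹, tor b ρ a * tor b ρ d)

theorem prodE_mul_tor_mem_grpB (l : List ι) (V a : ι → ℂ) :
    prodE b ρ l V * tor b ρ a ∈ grpB ρ b :=
  mul_mem (grpN_le_grpB b ρ (prodE_mem_grpN b ρ _ _)) (tor_mem_grpB b ρ _)

theorem prodF_mul_tor_mem_grpBm (l : List ι) (W d : ι → ℂ) :
    prodF b ρ l W * tor b ρ d ∈ grpBm ρ b :=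
  mul_mem (grpNm_le_grpBm b ρ (prodF_mem_grpNm b ρ _ _)) (tor_mem_grpBm b ρ _)

theorem mapI_eq (p : GL (Fin n) ℂ × GL (Fin n) ℂ) :
    mapI ρ b p = (p.1 * p.2⁻¹, theta ρ b p.1 * thetam ρ b p.2) := by
  simp [mapI, inclB, inclBm]

theorem chartPt_eq_mapI (l : List ι) (V W a d : ι → ℂ) : chartPt b ρ l V W a d =
    mapI ρ b (prodE b ρ l V * tor b ρ a, prodF b ρ l.reverse W * tor b ρ d) := by
  rw [mapI_eq, theta_mul_tor b ρ _ (prodE_mem_grpN b ρ _ _),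
    thetam_mul_tor b ρ _ (prodF_mem_grpNm b ρ _ _), chartPt]

theorem chartPt_mem_dblB (l : List ι) (V W a d : ι → ℂ) :
    chartPt b ρ l V W a d ∈ dblB ρ (𝔥 := 𝔥) :=
  Subgroup.mem_prod.2 ⟨mul_mem (grpB_le_grpG b ρ (prodE_mul_tor_mem_grpB b ρ _ _ _))
    (inv_mem (grpBm_le_grpG b ρ (prodF_mul_tor_mem_grpBm b ρ _ _ _))),
    mul_mem (tor_mem_grpH b ρ _) (tor_mem_grpH b ρ _)⟩

theorem dualDbl_mul_mem {x y : Amb n × Amb n} (hx : x ∈ dualDbl ρ b) (hy : y ∈ dualDbl ρ b) :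
    x * y ∈ dualDbl ρ b := by
  obtain ⟨g, hg, g', hg', rfl⟩ := hx
  obtain ⟨k, hk, k', hk', rfl⟩ := hy
  refine ⟨g * k, mul_mem hg hk, g' * k', mul_mem hg' hk', ?_⟩
  obtain ⟨c, hc⟩ := (mem_grpH_iff b ρ).1 (thetam_mem_grpH b ρ hg)
  obtain ⟨c', hc'⟩ := (mem_grpH_iff b ρ).1 (thetam_mem_grpH b ρ hk)
  simp only [inclB, inclBm, theta_mul b ρ hg' hk', thetam_mul b ρ hg hk, Prod.mk_mul_mk, hc, hc',
    ← tor_neg, ← tor_add, neg_add]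

/-- If U' = pUq with p, q ∈ B⁻ and L' = uLv with u, v ∈ B, then U'L'⁻¹ equals both p(UL⁻¹)(LqL'⁻¹)
and (U'v⁻¹U⁻¹)(UL⁻¹)u⁻¹. These give the B⁻- and B-entries of the two elements of J; the torus
conditions on p, q, u, v make the H-components agree. -/
theorem exists_chartPt_eq {l : List ι} (hl : l.Nodup) (hmem : ∀ i, i ∈ l)
    {V V' W W' a a' d d' : ι → ℂ} (hV : ∀ i, V i ≠ 0) (hV' : ∀ i, V' i ≠ 0)
    (hW : ∀ i, W i ≠ 0) (hW' : ∀ i, W' i ≠ 0) :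
    ∃ x ∈ dualDbl ρ b, ∃ y ∈ dualDbl ρ b,
      (chartPt b ρ l V' W' a' d', chartPt b ρ l V' W' a' d') =
        x * (chartPt b ρ l V W a d, chartPt b ρ l V W a d) * y := by
  obtain ⟨p, hp, q, hq, h1, h2⟩ :=
    exists_prodE_mul_tor_eq b ρ hl hmem hV hV' (a := a) (a' := a')
  obtain ⟨u, hu, v, hv, h3, h4⟩ := exists_prodE_mul_tor_eq b.symm ρ (List.nodup_reverse.2 hl)
    (fun i => List.mem_reverse.2 (hmem i)) hW hW' (a := -d) (a' := -d')
  rw [grpBm_symm] at hu hv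
  rw [tor_symm, tor_symm, neg_neg, neg_neg] at h3 h4
  change prodF b ρ l.reverse W' * _ = u * (prodF b ρ l.reverse W * _) * v at h3
  rw [thetam_symm] at h4
  obtain ⟨cp, hcp⟩ := (mem_grpH_iff b ρ).1 (thetam_mem_grpH b ρ hp)
  obtain ⟨cq, hcq⟩ := (mem_grpH_iff b ρ).1 (thetam_mem_grpH b ρ hq)
  obtain ⟨cu, hcu⟩ := (mem_grpH_iff b ρ).1 (theta_mem_grpH b ρ hu)
  obtain ⟨cv, hcv⟩ := (mem_grpH_iff b ρ).1 (theta_mem_grpH b ρ hv)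
  rw [hcp, hcq] at h2
  rw [hcu, hcv] at h4
  have hU := prodE_mul_tor_mem_grpB b ρ l V a
  have hU' := prodE_mul_tor_mem_grpB b ρ l V' a'
  have hL := prodF_mul_tor_mem_grpBm b ρ l.reverse W d
  have hL' := prodF_mul_tor_mem_grpBm b ρ l.reverse W' d'
  have tU := theta_mul_tor b ρ a (prodE_mem_grpN b ρ l V)
  have tU' := theta_mul_tor b ρ a' (prodE_mem_grpN b ρ l V')
  have tL := thetam_mul_tor b ρ d (prodF_mem_grpNm b ρ l.reverse W)
  have tL' := thetam_mul_tor b ρ d' (prodF_mem_grpNm b ρ l.reverse W')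
  simp only [chartPt]
  set U := prodE b ρ l V * tor b ρ a
  set U' := prodE b ρ l V' * tor b ρ a'
  set L := prodF b ρ l.reverse W * tor b ρ d
  set L' := prodF b ρ l.reverse W' * tor b ρ d'
  refine ⟨_, ⟨p, hp, U' * v⁻¹ * U⁻¹, mul_mem (mul_mem hU' (inv_mem hv)) (inv_mem hU), rfl⟩,
    _, ⟨L * q * L'⁻¹, mul_mem (mul_mem hL hq) (inv_mem hL'), u⁻¹, inv_mem hu, rfl⟩, ?_⟩
  simp only [inclB, inclBm, Prod.mk_mul_mk, Prod.mk.injEq]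
  refine ⟨⟨?_, ?_⟩, ?_, ?_⟩
  · rw [h1]; group
  · rw [thetam_mul b ρ (mul_mem hL hq) (inv_mem hL'), thetam_mul b ρ hL hq, thetam_inv b ρ hL', tL,
      tL', hcp, hcq, h2]
    simp only [← tor_neg, ← tor_add]
    congr 1
    abel
  · rw [h3]; group
  · rw [theta_mul b ρ (mul_mem hU' (inv_mem hv)) (inv_mem hU), theta_mul b ρ hU' (inv_mem hv),
      theta_inv b ρ hv, theta_inv b ρ hU, theta_inv b ρ hu, tU, tU', hcu, hcv, h4]
    simp only [← tor_neg, ← tor_add]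
    congr 1
    abel

theorem continuous_tor : Continuous (tor b ρ) := by
  refine continuous_expG_comp ρ ?_
  simp only [hSum_apply, map_sum, map_smul]
  fun_prop

theorem continuous_prodE_exp (l : List ι) :
    Continuous fun v : ι → ℂ => prodE b ρ l fun i => Complex.exp (v i) := by
  induction l with
  | nil => exact continuous_const
  | cons i l ih =>
    simp only [prodE_cons]
    refine Continuous.mul (continuous_expG_comp ρ ?_) ih
    simp only [map_smul]
    fun_prop

/-- Taking V and W as exponentials exhibits the chart as a continuous image of a complex vector
space, so it is connected. As it lies in one J-orbit, it stays in one component. -/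
theorem chartPt_mem_symplecticLeaf {l : List ι} (hl : l.Nodup) (hmem : ∀ i, i ∈ l)
    {V V' W W' a a' d d' : ι → ℂ} (hV : ∀ i, V i ≠ 0) (hV' : ∀ i, V' i ≠ 0)
    (hW : ∀ i, W i ≠ 0) (hW' : ∀ i, W' i ≠ 0) {x₀ : Amb n}
    (h : chartPt b ρ l V W a d ∈ symplecticLeaf ρ b x₀) :
    chartPt b ρ l V' W' a' d' ∈ symplecticLeaf ρ b x₀ := by
  obtain ⟨-, j₁, hj₁, j₂, hj₂, hj⟩ := connectedComponentIn_subset _ _ h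
  rw [symplecticLeaf] at h ⊢
  rw [connectedComponentIn_eq h]
  let Ψ : (ι → ℂ) × (ι → ℂ) × (ι → ℂ) × (ι → ℂ) → Amb n := fun z =>
    chartPt b ρ l (fun i => Complex.exp (z.1 i)) (fun i => Complex.exp (z.2.1 i)) z.2.2.1 z.2.2.2
  have hΨ : Continuous Ψ := by
    have hE := continuous_prodE_exp b ρ l
    have hF := continuous_prodE_exp b.symm ρ l.reverse
    have hT := continuous_tor b ρ
    refine Continuous.prodMk (((hE.comp continuous_fst).mul (hT.comp (by fun_prop))).mul
      (((hF.comp (continuous_fst.comp continuous_snd)).mul (hT.comp (by fun_prop))).inv))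
      ((hT.comp (by fun_prop)).mul (hT.comp (by fun_prop)))
  have hlog : ∀ V : ι → ℂ, (∀ i, V i ≠ 0) → (fun i => Complex.exp (Complex.log (V i))) = V :=
    fun V hV => funext fun i => Complex.exp_log (hV i)
  have hmemΨ : ∀ {V W a d : ι → ℂ}, (∀ i, V i ≠ 0) → (∀ i, W i ≠ 0) →
      chartPt b ρ l V W a d ∈ Set.range Ψ := by
    intro V W a d hV hW
    refine ⟨(fun i => Complex.log (V i), fun i => Complex.log (W i), a, d), ?_⟩
    simp only [Ψ, hlog V hV, hlog W hW]
  refine (isPreconnected_range hΨ).subset_connectedComponentIn (hmemΨ hV hW) ?_ (hmemΨ hV' hW')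
  rintro _ ⟨z, rfl⟩
  refine ⟨chartPt_mem_dblB b ρ _ _ _ _ _, ?_⟩
  obtain ⟨x, hx, y, hy, hxy⟩ := exists_chartPt_eq b ρ hl hmem hV
    (fun i => Complex.exp_ne_zero (z.1 i)) hW (fun i => Complex.exp_ne_zero (z.2.1 i))
    (a := a) (d := d) (a' := z.2.2.1) (d' := z.2.2.2)
  refine ⟨x * j₁, dualDbl_mul_mem b ρ hx hj₁, j₂ * y, dualDbl_mul_mem b ρ hj₂ hy, ?_⟩
  refine hxy.trans ?_
  rw [hj]
  simp only [mul_assoc]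

end Leaf

theorem nodup_ofFn_equiv {ι : Type*} {r : ℕ} (w : Fin r ≃ ι) : (List.ofFn w).Nodup :=
  List.nodup_ofFn.2 w.injective

theorem mem_ofFn_equiv {ι : Type*} {r : ℕ} (w : Fin r ≃ ι) (i : ι) : i ∈ List.ofFn w :=
  List.mem_ofFn.2 ⟨w.symm i, w.apply_symm_apply i⟩

/-! ### From (A, B, C, D) to unipotent and torus coordinates -/

section Coordinates

variable {𝔤 : Type*} [LieRing 𝔤] [LieAlgebra ℂ 𝔤] {n : ℕ}
  {ι : Type*} [Fintype ι] {𝔥 : LieSubalgebra ℂ 𝔤} (b : LieAlgebra.Basis ι 𝔥)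
  (ρ : 𝔤 →ₗ⁅ℂ⁆ Matrix (Fin n) (Fin n) ℂ) {r : ℕ}

/-- The torus factor of letter j, moved to the right end, passes exactly the root factors at
positions k ≥ j, its own included. This is the source of the partial products in V_i and W_i. -/
theorem list_prod_ofFn_tor_mul_expG_e [DecidableEq ι] {m : ℕ} (u : Fin m → ι) (a β : Fin m → ℂ) :
    (List.ofFn fun k => expG ρ (a k • b.h (u k)) * expG ρ (β k • b.e (u k))).prod =
      (List.ofFn fun k => expG ρ ((Complex.exp
        (∑ j, if j ≤ k then a j * (b.A (u k) (u j) : ℂ) else 0) * β k) • b.e (u k))).prod *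
      tor b ρ (∑ k, Pi.single (u k) (a k)) := by
  induction m with
  | zero => simp
  | succ m ih =>
    rw [List.ofFn_succ', List.ofFn_succ', List.concat_eq_append, List.concat_eq_append,
      List.prod_append, List.prod_append, ih (fun k => u k.castSucc) (fun k => a k.castSucc)
        (fun k => β k.castSucc)]
    have e1 : expG ρ (a (Fin.last m) • b.h (u (Fin.last m))) =
        tor b ρ (Pi.single (u (Fin.last m)) (a (Fin.last m))) := by rw [tor, hSum_single]
    simp only [List.prod_singleton, Fin.sum_univ_castSucc, Fin.castSucc_le_castSucc_iff,
      Fin.le_last, if_true, (Fin.castSucc_lt_last _).not_ge, if_false, add_zero, e1]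
    have e2 := tor_mul_expG_e b ρ (∑ k : Fin m, Pi.single (u k.castSucc) (a k.castSucc) +
      Pi.single (u (Fin.last m)) (a (Fin.last m))) (β (Fin.last m)) (u (Fin.last m))
    simp only [map_add, map_sum, rootEval_single] at e2
    rw [mul_assoc, ← mul_assoc (tor b ρ _) (tor b ρ _), ← tor_add, e2]
    simp only [mul_assoc]

theorem prod_ite_le_eq {r : ℕ} (u : Fin r ≃ ι) (k : Fin r) (g : ι → ℂ) :
    ∏ j, (if j ≤ k then g (u j) else 1) = g (u k) * ∏ i with u.symm i < k, g i := by
  rw [Finset.prod_filter, ← Equiv.prod_comp u]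
  simp only [Equiv.symm_apply_apply]
  have h : g (u k) = ∏ j, if j = k then g (u j) else 1 := by simp
  rw [h, ← Finset.prod_mul_distrib]
  refine Finset.prod_congr rfl fun j _ => ?_
  rcases lt_trichotomy j k with h | h | h
  · simp [h, h.le, h.ne]
  · simp [h]
  · simp [h.not_ge, h.not_gt, h.ne']

theorem exp_sum_ite_eq {r : ℕ} (u : Fin r ≃ ι) (k : Fin r) (A : ι → ℂˣ) (m : ι → ℤ) :
    Complex.exp (∑ j, if j ≤ k then Complex.log (A (u j)) * (m (u j) : ℂ) else 0) =
      (A (u k) : ℂ) ^ m (u k) * ∏ i with u.symm i < k, (A i : ℂ) ^ m i := by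
  rw [Complex.exp_sum, ← prod_ite_le_eq u k fun i => (A i : ℂ) ^ m i]
  refine Finset.prod_congr rfl fun j _ => ?_
  split_ifs
  · rw [mul_comm, Complex.exp_int_mul, Complex.exp_log (A (u j)).ne_zero]
  · exact Complex.exp_zero

theorem prodU_eq (w : Fin r ≃ ι) (q : Coords ι) :
    prodU ρ b w q = prodE b ρ (List.ofFn w) (fun i => coordV (cartan b) w q i) *
      tor b ρ (fun i => Complex.log (q.A i)) := by
  classical
  have h := list_prod_ofFn_tor_mul_expG_e b ρ w (fun k => Complex.log (q.A (w k)))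
    fun k => (q.B (w k) : ℂ) / q.A (w k)
  rw [prodU]
  refine h.trans ?_
  congr 1
  · rw [prodE, List.map_ofFn]
    congr 2
    funext k
    simp only [Function.comp_apply]
    congr 2
    rw [exp_sum_ite_eq w k q.A (b.A (w k)), A_diag]
    have := (q.A (w k)).ne_zero
    simp only [coordV, cartan, Units.val_mul, Units.coe_prod, Units.val_zpow_eq_zpow_val,
      Equiv.symm_apply_apply, Matrix.transpose_apply]
    field_simp
  · rw [Equiv.sum_comp w fun i => (Pi.single i (Complex.log (q.A i)) : ι → ℂ),
      Finset.univ_sum_single fun i => Complex.log (q.A i)]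

theorem prodL_eq (w : Fin r ≃ ι) (q : Coords ι) :
    prodL ρ b w q = prodF b ρ (List.ofFn w).reverse (fun i => coordW (cartan b) w q i) *
      tor b ρ (fun i => Complex.log (q.D i)) := by
  classical
  -- L is treated as a U-type product for `b.symm` and the reversed word; the negated h_i account
  -- for the sign of log D.
  set u : Fin r ≃ ι := Fin.revPerm.trans w with hu
  have huk : ∀ k, u k = w k.rev := fun k => rfl
  have h := list_prod_ofFn_tor_mul_expG_e b.symm ρ u (fun k => -Complex.log (q.D (u k)))
    fun k => (q.C (u k) : ℂ) * q.D (u k)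
  have h0 : prodL ρ b w q = (List.ofFn fun k => expG ρ (-Complex.log (q.D (u k)) • b.symm.h (u k)) *
      expG ρ (((q.C (u k) : ℂ) * q.D (u k)) • b.symm.e (u k))).prod := by
    simp only [prodL, facL, huk, LieAlgebra.Basis.symm_h, LieAlgebra.Basis.symm_e, Pi.neg_apply,
      neg_smul, smul_neg, neg_neg]
  have hl : (List.ofFn w).reverse = List.ofFn u := by
    rw [List.ofFn_eq_map, List.ofFn_eq_map, ← List.map_reverse, List.finRange_reverse,
      List.map_map]
    rfl
  rw [h0, h, hl]
  congr 1
  · rw [prodF, prodE, List.map_ofFn]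
    congr 2
    funext k
    simp only [Function.comp_apply]
    congr 2
    have h1 : ∀ j, (if j ≤ k then -Complex.log (q.D (u j)) * (b.symm.A (u k) (u j) : ℂ) else 0) =
        if j ≤ k then Complex.log (q.D (u j)) * ((-b.A (u k) (u j) : ℤ) : ℂ) else 0 := by
      intro j
      rw [LieAlgebra.Basis.symm_A]
      push_cast
      rw [neg_mul, mul_neg]
    simp only [h1]
    rw [exp_sum_ite_eq u k q.D fun i => -b.A (u k) i, A_diag]
    have := (q.D (u k)).ne_zero
    have h2 : ∀ j, u.symm j < k ↔ w.symm (u k) < w.symm j := by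
      intro j
      rw [huk, Equiv.symm_apply_apply, ← Fin.rev_lt_rev]
      simp [hu]
    simp only [coordW, cartan, Units.val_mul, Units.coe_prod, Units.val_zpow_eq_zpow_val,
      Matrix.transpose_apply, h2, Units.val_inv_eq_inv_val]
    rw [_root_.zpow_neg]
    field_simp
  · rw [Equiv.sum_comp u fun i => (Pi.single i (-Complex.log (q.D i)) : ι → ℂ),
      Finset.univ_sum_single fun i => -Complex.log (q.D i), tor_symm]
    congr 1
    funext i
    simp

theorem chi_snd_eq (w : Fin r ≃ ι) (q : Coords ι) (i : ι) :
    ((chi (cartan b) w q).2 i : ℂ) = coordV (cartan b) w q i * coordW (cartan b) w q i *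
      Complex.exp (-rootEval b i
        ((fun i => Complex.log (q.A i)) - fun i => Complex.log (q.D i))) := by
  simp only [chi, Units.val_mul, Units.coe_prod, Units.val_zpow_eq_zpow_val,
    Units.val_div_eq_div_val, cartan, Matrix.transpose_apply]
  congr 1
  rw [rootEval_apply, ← Finset.sum_neg_distrib, Complex.exp_sum]
  refine Finset.prod_congr rfl fun j _ => ?_
  rw [Pi.sub_apply, show -((Complex.log (q.A j) - Complex.log (q.D j)) * (b.A i j : ℂ)) =
    ((-b.A i j : ℤ) : ℂ) * (Complex.log (q.A j) - Complex.log (q.D j)) by push_cast; ring,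
    Complex.exp_int_mul, Complex.exp_sub, Complex.exp_log (q.A j).ne_zero,
    Complex.exp_log (q.D j).ne_zero]

theorem point_eq_chartPt (w : Fin r ≃ ι) (q : Coords ι) :
    point ρ b w q = chartPt b ρ (List.ofFn w) (fun i => coordV (cartan b) w q i)
      (fun i => coordW (cartan b) w q i) (fun i => Complex.log (q.A i))
      (fun i => Complex.log (q.D i)) := by
  rw [point, prodU_eq, prodL_eq, chartPt_eq_mapI]

theorem exists_point_eq_chartPt (w : Fin r ≃ ι) {V W : ι → ℂ} (hV : ∀ i, V i ≠ 0)
    (hW : ∀ i, W i ≠ 0) (a d : ι → ℂ) :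
    ∃ q, point ρ b w q = chartPt b ρ (List.ofFn w) V W a d ∧
      (∀ i, (coordV (cartan b) w q i : ℂ) = V i) ∧ (∀ i, (coordW (cartan b) w q i : ℂ) = W i) ∧
      (∀ i, (q.A i : ℂ) = Complex.exp (a i)) ∧ ∀ i, (q.D i : ℂ) = Complex.exp (d i) := by
  let A : ι → ℂˣ := fun i => Units.mk0 _ (Complex.exp_ne_zero (a i))
  let D : ι → ℂˣ := fun i => Units.mk0 _ (Complex.exp_ne_zero (d i))
  let q₀ : Coords ι := ⟨A, 1, 1, D⟩
  let q : Coords ι := ⟨A, fun i => Units.mk0 _ (hV i) / coordV (cartan b) w q₀ i,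
    fun i => Units.mk0 _ (hW i) / coordW (cartan b) w q₀ i, D⟩
  have h1 : ∀ i, coordV (cartan b) w q i = Units.mk0 _ (hV i) := by
    intro i
    simp only [coordV, q, q₀, Pi.one_apply, one_mul, mul_assoc, div_mul_cancel]
  have h2 : ∀ i, coordW (cartan b) w q i = Units.mk0 _ (hW i) := by
    intro i
    simp only [coordW, q, q₀, Pi.one_apply, one_mul, mul_assoc, div_mul_cancel]
  refine ⟨q, ?_, fun i => by rw [h1]; rfl, fun i => by rw [h2]; rfl, fun i => rfl, fun i => rfl⟩
  rw [point_eq_chartPt]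
  simp only [h1, h2, Units.val_mk0]
  have h3 : tor b ρ (fun i => Complex.log (q.A i)) = tor b ρ a := tor_log_exp b ρ a
  have h4 : tor b ρ (fun i => Complex.log (q.D i)) = tor b ρ d := tor_log_exp b ρ d
  rw [chartPt, h3, h4, chartPt]

theorem chartPt_fst_eq (l : List ι) (V W a d : ι → ℂ) :
    (chartPt b ρ l V W a d).1 =
      prodE b ρ l V * tor b ρ (a - d) * (prodF b ρ l.reverse W)⁻¹ := by
  rw [chartPt, tor_sub]
  group

theorem chartPt_unique (hρ : Function.Injective ρ) {l : List ι} (hl : l.Nodup)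
    (hmem : ∀ i, i ∈ l) {V V' W W' a a' d d' : ι → ℂ}
    (h : chartPt b ρ l V W a d = chartPt b ρ l V' W' a' d') :
    V = V' ∧ W = W' ∧ tor b ρ (a - d) = tor b ρ (a' - d') := by
  have h1 := congrArg (fun x : Amb n => x.1⁻¹) h
  simp only [chartPt_fst_eq, _root_.mul_inv_rev, inv_inv, ← tor_neg, ← mul_assoc] at h1
  obtain ⟨h2, h3, h4⟩ := gauss_unique b ρ hρ (prodF_mem_grpNm b ρ _ _) (prodF_mem_grpNm b ρ _ _)
    (inv_mem (prodE_mem_grpN b ρ _ _)) (inv_mem (prodE_mem_grpN b ρ _ _)) h1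
  rw [tor_neg, tor_neg, _root_.inv_inj] at h3
  exact ⟨prodE_injective b ρ hl hmem hρ (inv_injective h4),
    prodF_injective b ρ (List.nodup_reverse.2 hl) (fun i => List.mem_reverse.2 (hmem i)) hρ h2, h3⟩

theorem chi_eq_of_point_eq (hρ : Function.Injective ρ) (w : Fin r ≃ ι) {q q' : Coords ι}
    (h : point ρ b w q = point ρ b w q') : chi (cartan b) w q = chi (cartan b) w q' := by
  rw [point_eq_chartPt, point_eq_chartPt] at h
  obtain ⟨h1, h2, h3⟩ := chartPt_unique b ρ hρ (nodup_ofFn_equiv w) (mem_ofFn_equiv w) h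
  have h1' := fun i => congrFun h1 i
  have h2' := fun i => congrFun h2 i
  refine Prod.ext (funext fun i => Units.ext ?_) (funext fun i => Units.ext ?_)
  · simp only [chi, Units.val_mul, h1', h2']
  · rw [chi_snd_eq, chi_snd_eq, h1' i, h2' i, Complex.exp_neg, Complex.exp_neg,
      exp_rootEval_eq b ρ hρ h3]

end Coordinates

/-! ### The factorization relation in coordinates -/

section FactorizationRelation

variable {𝔤 : Type*} [LieRing 𝔤] [LieAlgebra ℂ 𝔤] {n : ℕ}
  {ι : Type*} [Fintype ι] {𝔥 : LieSubalgebra ℂ 𝔤} (b : LieAlgebra.Basis ι 𝔥)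
  (ρ : 𝔤 →ₗ⁅ℂ⁆ Matrix (Fin n) (Fin n) ℂ) {r : ℕ}

theorem chartPt_fst_eq_prodE_mul_prodF (l : List ι) (V W a d : ι → ℂ) :
    (chartPt b ρ l V W a d).1 = prodE b ρ l V *
      prodF b ρ l (fun i => -(Complex.exp (-rootEval b i (a - d)) * W i)) * tor b ρ (a - d) := by
  rw [chartPt_fst_eq, prodF_inv, List.reverse_reverse, mul_assoc, tor_mul_prodF, mul_assoc]
  simp only [Pi.neg_apply, mul_neg]

theorem prodF_inv_mul_prodE_eq (l : List ι) (V W a d : ι → ℂ) :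
    (prodF b ρ l.reverse W * tor b ρ d)⁻¹ * (prodE b ρ l V * tor b ρ a) =
      prodF b ρ l (fun i => -(Complex.exp (rootEval b i d) * W i)) *
        prodE b ρ l (fun i => Complex.exp (-rootEval b i d) * V i) * tor b ρ (a - d) := by
  have h1 := tor_mul_prodF b ρ (-d) l (-W)
  have h2 := tor_mul_prodE b ρ (-d) l V
  simp only [map_neg, neg_neg, Pi.neg_apply, mul_neg] at h1 h2
  rw [_root_.mul_inv_rev, prodF_inv, List.reverse_reverse, ← tor_neg, ← mul_assoc, h1,
    mul_assoc (prodF b ρ l _), h2, sub_eq_neg_add, tor_add]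
  simp only [mul_assoc]

/-- A factorization of a point of the chart in the opposite order determines the coordinates
`χ` of its factors. -/
theorem chi_of_chartPt_fst_eq (hρ : Function.Injective ρ) {l : List ι} (hl : l.Nodup)
    (hmem : ∀ i, i ∈ l) {V W V' W' a d a' d' : ι → ℂ} (hV : ∀ i, V i ≠ 0) (hV' : ∀ i, V' i ≠ 0)
    (h : (chartPt b ρ l V W a d).1 =
      (prodF b ρ l.reverse W' * tor b ρ d')⁻¹ * (prodE b ρ l V' * tor b ρ a')) :
    ∃ s : ι → ℂ,
      (∀ i, Complex.exp (s i) = 1 - V i * W i * Complex.exp (-rootEval b i (a - d))) ∧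
      ∀ i, V' i * W' i = V i * W i * Complex.exp (-rootEval b i (a - d)) ∧
        Complex.exp (-rootEval b i (a' - d')) =
          Complex.exp (-rootEval b i (a - d)) * Complex.exp (-rootEval b i s) := by
  rw [chartPt_fst_eq_prodE_mul_prodF, prodF_inv_mul_prodE_eq] at h
  set γ : ι → ℂ := fun i => -(Complex.exp (-rootEval b i (a - d)) * W i) with hγ
  have hne : ∀ i, 1 + V i * γ i ≠ 0 := fun i =>
    one_add_mul_ne_zero b ρ hρ hl (hmem i) (mul_ne_zero (Complex.exp_ne_zero _) (hV' i)) h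
  set s : ι → ℂ := fun i => Complex.log (1 + V i * γ i)
  have hs : ∀ i, Complex.exp (s i) = 1 + V i * γ i := fun i => Complex.exp_log (hne i)
  obtain ⟨γ', V₁, h1, h2⟩ := exists_prodE_mul_prodF_eq_of_forall_mem b ρ hl hmem hV hs
  -- Both sides are brought to the form N⁻HN, so that uniqueness compares the three parts
  -- separately.
  rw [h1, mul_assoc, prodE_mul_tor, ← mul_assoc, mul_assoc (prodF b ρ l γ'), ← tor_add,
    mul_assoc (prodF b ρ l fun i => -(_ * W' i)), prodE_mul_tor, ← mul_assoc] at h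
  obtain ⟨h3, h4, h5⟩ := gauss_unique b ρ hρ (prodF_mem_grpNm b ρ _ _) (prodF_mem_grpNm b ρ _ _)
    (prodE_mem_grpN b ρ _ _) (prodE_mem_grpN b ρ _ _) h
  have h3' := prodF_injective b ρ hl hmem hρ h3
  have h5' := prodE_injective b ρ hl hmem hρ h5
  refine ⟨s, fun i => by rw [hs, hγ]; ring, fun i => ?_⟩
  have h6 := exp_rootEval_eq b ρ hρ h4 i
  have h7 := congrFun h3' i
  have h8 := congrFun h5' i
  have h9 := (h2 i).1
  rw [map_add, Complex.exp_add] at h6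
  simp only [hγ, Complex.exp_neg] at h7 h8 h9 ⊢
  have n1 := Complex.exp_ne_zero (rootEval b i (a - d))
  have n2 := Complex.exp_ne_zero (rootEval b i (a' - d'))
  have n3 := Complex.exp_ne_zero (rootEval b i s)
  have n4 := Complex.exp_ne_zero (rootEval b i d')
  rw [← h6] at h8 n2 ⊢
  generalize Complex.exp (rootEval b i (a - d)) = x at *
  generalize Complex.exp (rootEval b i s) = y at *
  generalize Complex.exp (rootEval b i d') = z at *
  refine ⟨?_, by rw [mul_inv, mul_comm]⟩
  field_simp at h8 h9 ⊢
  rw [h7] at h9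
  have h10 : V' i = y * z * V₁ i := by linear_combination -h8
  rw [h10]
  linear_combination -h9

/-- A point of the chart with `χ⁻_i ≠ 1` is factorized in the opposite order. -/
theorem exists_chartPt_fst_eq {l : List ι} (hl : l.Nodup) (hmem : ∀ i, i ∈ l)
    {V W a d : ι → ℂ} (hV : ∀ i, V i ≠ 0) (hW : ∀ i, W i ≠ 0)
    (hne : ∀ i, V i * W i * Complex.exp (-rootEval b i (a - d)) ≠ 1) :
    ∃ V' W' a' d' : ι → ℂ, (∀ i, V' i ≠ 0) ∧ (∀ i, W' i ≠ 0) ∧ a' + d' = a + d ∧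
      (chartPt b ρ l V W a d).1 =
        (prodF b ρ l.reverse W' * tor b ρ d')⁻¹ * (prodE b ρ l V' * tor b ρ a') := by
  set γ : ι → ℂ := fun i => -(Complex.exp (-rootEval b i (a - d)) * W i) with hγ
  have hne' : ∀ i, 1 + V i * γ i ≠ 0 := fun i hi => hne i (by
    rw [hγ] at hi
    linear_combination -hi)
  set s : ι → ℂ := fun i => Complex.log (1 + V i * γ i)
  have hs : ∀ i, Complex.exp (s i) = 1 + V i * γ i := fun i => Complex.exp_log (hne' i)
  obtain ⟨γ', V₁, h1, h2⟩ := exists_prodE_mul_prodF_eq_of_forall_mem b ρ hl hmem hV hs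
  -- The new torus part needs a' - d' = (a - d) + s, while the H-component needs a' + d' = a + d;
  -- hence the halves.
  set d' : ι → ℂ := d - (2⁻¹ : ℂ) • s with hd'
  set a' : ι → ℂ := a + (2⁻¹ : ℂ) • s with ha'
  have hγ' : ∀ i, γ' i ≠ 0 := fun i h0 => by
    have := (h2 i).1
    rw [h0, mul_zero] at this
    exact mul_ne_zero (mul_ne_zero (hV i) (neg_ne_zero.2
      (mul_ne_zero (Complex.exp_ne_zero _) (hW i)))) (Complex.exp_ne_zero _) this.symm
  refine ⟨fun i => Complex.exp (rootEval b i d') * (Complex.exp (rootEval b i s) * V₁ i),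
    fun i => -(Complex.exp (-rootEval b i d') * γ' i), a', d',
    fun i => mul_ne_zero (Complex.exp_ne_zero _) (mul_ne_zero (Complex.exp_ne_zero _) (h2 i).2),
    fun i => neg_ne_zero.2 (mul_ne_zero (Complex.exp_ne_zero _) (hγ' i)), ?_, ?_⟩
  · rw [ha', hd']; abel
  · rw [chartPt_fst_eq_prodE_mul_prodF, ← hγ, prodF_inv_mul_prodE_eq, h1,
      show a' - d' = s + (a - d) by rw [ha', hd']; module, tor_add, mul_assoc (prodF b ρ l γ'),
      tor_mul_prodE]
    simp only [← mul_assoc, ← Complex.exp_add, neg_add_cancel_left, add_neg_cancel,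
      Complex.exp_zero, one_mul, mul_neg, neg_neg]

/-- The elements of `B × B⁻` over a point of the chart. -/
theorem exists_of_mapI_eq (hρ : Function.Injective ρ) {l : List ι} {V W a d : ι → ℂ}
    {q : GL (Fin n) ℂ × GL (Fin n) ℂ} (hq1 : q.1 ∈ grpB ρ b) (hq2 : q.2 ∈ grpBm ρ b)
    (h : mapI ρ b q = chartPt b ρ l V W a d) :
    ∃ a' d', a' - d' = a - d ∧ q.1 = prodE b ρ l V * tor b ρ a' ∧
      q.2 = prodF b ρ l.reverse W * tor b ρ d' := by
  have h1 := congrArg Prod.fst h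
  rw [mapI_eq, chartPt] at h1
  set U := prodE b ρ l V * tor b ρ a with hU
  set L := prodF b ρ l.reverse W * tor b ρ d with hL
  simp only at h1
  -- The common value lies in B ∩ B⁻ = H, so two preimages of a point differ by right multiplication
  -- of both entries with one torus element.
  have h2 : U⁻¹ * q.1 = L⁻¹ * q.2 := by
    rw [mul_inv_eq_iff_eq_mul] at h1
    rw [h1]
    group
  obtain ⟨u, hu⟩ := mem_grpH_of_mem_grpB_of_mem_grpBm b ρ hρ
    (mul_mem (inv_mem (prodE_mul_tor_mem_grpB b ρ l V a)) hq1)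
    (by rw [← hU, h2]; exact mul_mem (inv_mem (prodF_mul_tor_mem_grpBm b ρ _ _ _)) hq2)
  refine ⟨a + u, d + u, by abel, ?_, ?_⟩
  · rw [tor_add, ← mul_assoc, ← hU, ← hu, mul_inv_cancel_left]
  · rw [tor_add, ← mul_assoc, ← hL, ← hu, ← hU, h2, mul_inv_cancel_left]

theorem alpha_snd_eq {p : Torus ι} (hp : p ∈ alphaDom ι) {s : ι → ℂ}
    (hs : ∀ i, Complex.exp (s i) = 1 - (p.2 i : ℂ)) (i : ι) :
    ((alpha (cartan b) ⟨p, hp⟩).2 i : ℂ) =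
      (p.2 i : ℂ) ^ 2 / p.1 i * Complex.exp (-rootEval b i s) := by
  simp only [alpha, Units.val_mul, Units.coe_prod, Units.val_zpow_eq_zpow_val,
    Units.val_div_eq_div_val, cartan, Matrix.transpose_apply, Units.val_pow_eq_pow_val,
    Units.val_mk0]
  congr 1
  rw [rootEval_apply, ← Finset.sum_neg_distrib, Complex.exp_sum]
  refine Finset.prod_congr rfl fun j _ => ?_
  rw [show -(s j * (b.A i j : ℂ)) = ((-b.A i j : ℤ) : ℂ) * s j by push_cast; ring,
    Complex.exp_int_mul, hs]

end FactorizationRelation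

end

end CoxeterToda

/-! ### The commuting diagram -/

theorem mainTheorem2
    {𝔤 : Type*} [LieRing 𝔤] [LieAlgebra ℂ 𝔤] [FiniteDimensional ℂ 𝔤] [LieAlgebra.IsSimple ℂ 𝔤]
    {ι : Type*} [Fintype ι] {𝔥 : LieSubalgebra ℂ 𝔤} (b : LieAlgebra.Basis ι 𝔥)
    {n : ℕ} (ρ : 𝔤 →ₗ⁅ℂ⁆ Matrix (Fin n) (Fin n) ℂ) (hρ : Function.Injective ρ)
    {r : ℕ} (w : Fin r ≃ ι)
    (S : Set (CoxeterToda.Amb n)) (hS : CoxeterToda.IsCoxeterLeaf ρ b w S)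
    (hS' : (CoxeterToda.chartPart ρ b w S).Nonempty) :
    ∃ χ : CoxeterToda.chartPart ρ b w S → CoxeterToda.Torus ι,
      (∀ (q : CoxeterToda.Coords ι)
          (hq : CoxeterToda.point ρ b w q ∈ CoxeterToda.chartPart ρ b w S),
        χ ⟨CoxeterToda.point ρ b w q, hq⟩ = CoxeterToda.chi (CoxeterToda.cartan b) w q) ∧
      Function.Surjective χ ∧
      (∀ z ∈ CoxeterToda.factRelOn ρ b w S,
        ∃ h : χ z.1 ∈ CoxeterToda.alphaDom ι,
          χ z.2 = CoxeterToda.alpha (CoxeterToda.cartan b) ⟨χ z.1, h⟩) ∧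
      (∀ x, χ x ∈ CoxeterToda.alphaDom ι → ∃ y, (x, y) ∈ CoxeterToda.factRelOn ρ b w S) := by
  open CoxeterToda in
  have hnd := nodup_ofFn_equiv w
  have hmem := mem_ofFn_equiv w
  have hmemS : ∀ q, point ρ b w q ∈ chartPart ρ b w S := by
    intro q
    obtain ⟨⟨x₀, -, rfl⟩, -⟩ := hS
    obtain ⟨x, hx, q₀, rfl⟩ := hS'
    refine ⟨?_, q, rfl⟩
    rw [point_eq_chartPt] at hx ⊢
    exact chartPt_mem_symplecticLeaf b ρ hnd hmem (fun i => Units.ne_zero _)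
      (fun i => Units.ne_zero _) (fun i => Units.ne_zero _) (fun i => Units.ne_zero _) hx
  -- χ is computed from arbitrary coordinates of each point; `chi_eq_of_point_eq` makes the choice
  -- harmless.
  choose Q hQ using fun x : chartPart ρ b w S => x.2.2
  have hχ : ∀ (q : Coords ι) (hq : point ρ b w q ∈ chartPart ρ b w S),
      chi (cartan b) w (Q ⟨point ρ b w q, hq⟩) = chi (cartan b) w q := fun q hq =>
    chi_eq_of_point_eq b ρ hρ w (hQ _)
  have hchi : ∀ (V W a d : ι → ℂ) (x : chartPart ρ b w S), (x : Amb n) =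
      chartPt b ρ (List.ofFn w) V W a d → ∀ i,
      ((chi (cartan b) w (Q x)).1 i : ℂ) = V i * W i ∧
      ((chi (cartan b) w (Q x)).2 i : ℂ) =
        V i * W i * Complex.exp (-rootEval b i (a - d)) := by
    intro V W a d x hx i
    rw [← hQ x, point_eq_chartPt] at hx
    obtain ⟨h1, h2, h3⟩ := chartPt_unique b ρ hρ hnd hmem hx
    subst h1 h2
    refine ⟨rfl, ?_⟩
    rw [chi_snd_eq, Complex.exp_neg, Complex.exp_neg, exp_rootEval_eq b ρ hρ h3]
  have hex : ∀ (V W a d : ι → ℂ), (∀ i, V i ≠ 0) → (∀ i, W i ≠ 0) →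
      chartPt b ρ (List.ofFn w) V W a d ∈ chartPart ρ b w S := by
    intro V W a d hV hW
    obtain ⟨q, hq, -⟩ := exists_point_eq_chartPt b ρ w hV hW a d
    exact hq ▸ hmemS q
  have hcoord : ∀ x : chartPart ρ b w S, ∃ V W a d : ι → ℂ, (∀ i, V i ≠ 0) ∧ (∀ i, W i ≠ 0) ∧
      (x : Amb n) = chartPt b ρ (List.ofFn w) V W a d := fun x =>
    ⟨_, _, _, _, fun i => Units.ne_zero _, fun i => Units.ne_zero _,
      (hQ x).symm.trans (point_eq_chartPt b ρ w (Q x))⟩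
  refine ⟨fun x => chi (cartan b) w (Q x), hχ, fun t => ?_, fun z hz => ?_, fun x hx => ?_⟩
  -- The preimage has V = χ⁺, W = 1, d = 0, and root characters exp(α_k(a)) = χ⁺_k/χ⁻_k.
  · obtain ⟨a, ha⟩ := exists_rootEval_eq b fun k => Complex.log ((t.1 k : ℂ) / t.2 k)
    have h := hex (fun i => t.1 i) (fun _ => 1) a 0 (fun i => Units.ne_zero _)
      (fun _ => one_ne_zero)
    refine ⟨⟨_, h⟩, ?_⟩
    have h' := hchi _ _ _ _ ⟨_, h⟩ rfl
    refine Prod.ext (funext fun i => Units.ext ?_) (funext fun i => Units.ext ?_)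
    · rw [(h' i).1, mul_one]
    · have h1 := (t.1 i).ne_zero
      have h2 := (t.2 i).ne_zero
      rw [(h' i).2, sub_zero, ha, Complex.exp_neg, Complex.exp_log (div_ne_zero h1 h2)]
      field_simp
  · obtain ⟨x, y⟩ := z
    obtain ⟨p, q, ⟨⟨hp1, hp2⟩, ⟨hq1, hq2⟩, hpq⟩, hpx, hqy⟩ := hz
    obtain ⟨V, W, a, d, hV, hW, hx⟩ := hcoord x
    obtain ⟨V', W', a', d', hV', hW', hy⟩ := hcoord y
    -- The pair witnessing the relation may differ from the chosen coordinates of y by a torus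
    -- element; χ sees only the difference a₁ - d₁, which is unchanged.
    obtain ⟨a₁, d₁, had, hq1', hq2'⟩ := exists_of_mapI_eq b ρ hρ hq1 hq2 (hqy.trans hy)
    have h1 : (chartPt b ρ (List.ofFn w) V W a d).1 = q.2⁻¹ * q.1 := by
      rw [← hx, ← hpx]
      exact congrArg Prod.fst hpq
    rw [hq1', hq2'] at h1
    obtain ⟨s, hs, hs'⟩ := chi_of_chartPt_fst_eq b ρ hρ hnd hmem hV hV' h1
    have cx := hchi V W a d x hx
    have cy := hchi V' W' a' d' y hy
    have hs2 : ∀ i, Complex.exp (s i) = 1 - ((chi (cartan b) w (Q x)).2 i : ℂ) := fun i => by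
      rw [hs, (cx i).2]
    have hdom : chi (cartan b) w (Q x) ∈ alphaDom ι := fun i hi =>
      Complex.exp_ne_zero (s i) (by rw [hs2, hi, sub_self])
    refine ⟨hdom, Prod.ext (funext fun i => Units.ext ?_) (funext fun i => Units.ext ?_)⟩
    · exact ((cy i).1.trans (hs' i).1).trans (cx i).2.symm
    · rw [alpha_snd_eq b hdom hs2, (cy i).2, (cx i).1, (cx i).2, ← had, (hs' i).2, (hs' i).1]
      have h2 := hV i
      have h3 := hW i
      field_simp
  · obtain ⟨V, W, a, d, hV, hW, hxc⟩ := hcoord x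
    have cx := hchi V W a d x hxc
    obtain ⟨V', W', a', d', hV', hW', hsum, h⟩ := exists_chartPt_fst_eq b ρ hnd hmem hV hW
      fun i hi => hx i (by rw [(cx i).2, hi])
    refine ⟨⟨_, hex V' W' a' d' hV' hW'⟩, (_, _), (_, _),
      ⟨⟨prodE_mul_tor_mem_grpB b ρ _ V a, prodF_mul_tor_mem_grpBm b ρ _ W d⟩,
        ⟨prodE_mul_tor_mem_grpB b ρ _ V' a', prodF_mul_tor_mem_grpBm b ρ _ W' d'⟩, ?_⟩,
      (chartPt_eq_mapI b ρ (List.ofFn w) V W a d).symm.trans hxc.symm,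
      (chartPt_eq_mapI b ρ (List.ofFn w) V' W' a' d').symm⟩
    refine (chartPt_eq_mapI b ρ (List.ofFn w) V W a d).symm.trans (Prod.ext h ?_)
    simp only [chartPt, inclB, inclBm, Prod.snd_mul, Prod.snd_inv, inv_inv]
    rw [theta_mul_tor b ρ _ (prodE_mem_grpN b ρ _ _), thetam_mul_tor b ρ _ (prodF_mem_grpNm b ρ _ _),
      ← tor_add, ← tor_add, ← hsum, add_comm]
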